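/- Let $k$ be a commutative rig (commutative semiring). A \emph{cartesian left-$k$-linear category} is a category with chosen finite products whose hom-sets are $k$-modules, such that precomposition with any map is $k$-linear and the bijections $\mathcal A(A,B\times C)\to\mathcal A(A,B)\oplus\mathcal A(A,C)$ are $k$-linear. A map is $k$-linear in a given variable if postcomposition with it is $k$-linear in that argument. A \emph{($k$-linear) cartesian differential category} is a cartesian left-$k$-linear category with operators $\mathrm D\colon\mathcal A(A,B)\to\mathcal A(A\times A,B)$ such that: (i) $\mathrm D$ is $k$-linear; (ii) each $\mathrm Df$ is $k$-linear in its second argument; (iii) $\mathrm D\pi_i=\pi_i\pi_1$; (iv) $\mathrm D1_A=\pi_1$; (v) $\mathrm D(gf)=\mathrm Dg\,(f\pi_0,\mathrm Df)$; (vi) $\mathrm D\mathrm Df(x,r,0,v)=\mathrm Df(x,v)$; (vii) $\mathrm D\mathrm Df(x,r,s,0)=\mathrm D\mathrm Df(x,s,r,0)$. Maps of cartesian left-$k$-linear categories are functors preserving the $k$-module structure of homs and the chosen finite products strictly; maps of cartesian differential categories moreover preserve $\mathrm D$. Write $\mathrm{c}\ell k\mathbf{Lin}$ and $\mathrm{c}\mathbf{Diff}$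 for the resulting categories. For a cartesian left-$k$-linear category $\mathcal A$, the \emph{Faà di Bruno category} $\mathsf{Fa\grave a}(\mathcal A)$ has the objects of $\mathcal A$. A morphism $f^{(\bullet)}\colon A\rightsquigarrow B$ is a family of maps $f^{(n)}\colon A\times A^n\to B$ $(n\in\mathbb N)$ of $\mathcal A$, each symmetric and $k$-linear in each of its last $n$ variables. Identities are given by $\mathrm{id}^{(0)}=\mathrm{id}$, $\mathrm{id}^{(1)}=\pi_1$, $\mathrm{id}^{(n)}=0$ for $n\ge2$, and composition by $$(g\circ f)^{(n)}=\sum_{[n]=A_1\mid\cdots\mid A_m}g^{(m)}\circ\bigl(f^{(\emptyset)},f^{(A_1)},\dots,f^{(A_m)}\bigr),$$ the sum being over all unordered partitions of $[n]=\{1,\dots,n\}$ into non-empty blocks, where $f^{(I)}(x_0,\dots,x_n)=f^{(i)}(x_0,x_{n_1},\dots,x_{n_i})$ for $I=\{n_1<\dots<n_i\}$. Its hom-sets have the componentwise $k$-module structure, its finite products are those of $\mathcal A$ with projections $(\pi_i)^{(0)}=\pi_i$, $(\pi_i)^{(1)}=\pi_i\pi_1$, $(\pi_i)^{(n)}=0$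 for $n\ge2$, and its differential is $$(\mathrm Df)^{(n)}(x_0,y_0,\dots,x_n,y_n)=f^{(n+1)}(x_0,\dots,x_n,y_0)+\sum_{i=1}^n f^{(n)}(x_0,\dots,x_{i-1},y_i,x_{i+1},\dots,x_n);$$ with this structure it is a cartesian differential category. Let $\varepsilon_{\mathcal A}\colon\mathsf{Fa\grave a}(\mathcal A)\to\mathcal A$ be the map of cartesian left-$k$-linear categories which is the identity on objects and sends $f^{(\bullet)}$ to $f^{(0)}$. \textbf{Theorem.} For every cartesian left-$k$-linear category $\mathcal A$, the map $\varepsilon_{\mathcal A}$ exhibits $\mathsf{Fa\grave a}(\mathcal A)$ as the cofree cartesian differential category on $\mathcal A$: for every cartesian differential category $\mathcal B$ and every map $F\colon\mathcal B\to\mathcal A$ of cartesian left-$k$-linear categories there is a unique map $\tilde F\colon\mathcal B\to\mathsf{Fa\grave a}(\mathcal A)$ of cartesian differential categories with $F=\varepsilon_{\mathcal A}\circ\tilde F$. Equivalently, the forgetful functor $\mathrm{c}\mathbf{Diff}\to\mathrm{c}\ell k\mathbf{Lin}$ has a right adjoint, whose value at $\mathcal A$ is $\mathsf{Fa\grave a}(\mathcal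 A)$ and whose counit at $\mathcal A$ is $\varepsilon_{\mathcal A}$. -/

import Mathlib

open CategoryTheory MonoidalCategory CartesianMonoidalCategory

universe w v u v₁ u₁ v₂ u₂ v₃ u₃

set_option linter.unusedSectionVars false
set_option linter.checkUnivs false

/-! ### Cartesian left-`k`-linear categories -/

/-- Commutative monoid structures on the hom-sets of a category, preserved by precomposition. -/
class LeftAdditive (C : Type u) [Category.{v} C] where
  homAddCommMonoid : ∀ X Y : C, AddCommMonoid (X ⟶ Y)
  comp_add : ∀ {X Y Z : C} (f : X ⟶ Y) (g h : Y ⟶ Z), f ≫ (g + h) = f ≫ g + f ≫ h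
  comp_zero : ∀ {X Y : C} (f : X ⟶ Y) (Z : C), f ≫ (0 : Y ⟶ Z) = 0

attribute [reducible, instance] LeftAdditive.homAddCommMonoid

/-- A left-`k`-linear category: each hom-set is a `k`-module, and precomposition with any
map is `k`-linear. -/
class LeftLinear (k : Type w) [CommSemiring k] (C : Type u) [Category.{v} C]
    [LeftAdditive C] where
  homModule : ∀ X Y : C, Module k (X ⟶ Y)
  comp_smul : ∀ {X Y Z : C} (f : X ⟶ Y) (r : k) (g : Y ⟶ Z), f ≫ (r • g) = r • (f ≫ g)

attribute [reducible, instance] LeftLinear.homModule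

/-- A cartesian left-`k`-linear category: finite products are chosen, and the bijections
`(A ⟶ B ⊗ C) ≃ (A ⟶ B) × (A ⟶ C)`, that is, postcomposition with the two projections,
are `k`-linear. -/
class CartesianLeftLinear (k : Type w) [CommSemiring k] (C : Type u) [Category.{v} C]
    [CartesianMonoidalCategory C] [LeftAdditive C] [LeftLinear k C] : Prop where
  add_fst : ∀ {A X Y : C} (f g : A ⟶ X ⊗ Y), (f + g) ≫ fst X Y = f ≫ fst X Y + g ≫ fst X Y
  add_snd : ∀ {A X Y : C} (f g : A ⟶ X ⊗ Y), (f + g) ≫ snd X Y = f ≫ snd X Y + g ≫ snd X Y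
  smul_fst : ∀ {A X Y : C} (r : k) (f : A ⟶ X ⊗ Y), (r • f) ≫ fst X Y = r • (f ≫ fst X Y)
  smul_snd : ∀ {A X Y : C} (r : k) (f : A ⟶ X ⊗ Y), (r • f) ≫ snd X Y = r • (f ≫ snd X Y)

/-! ### Cartesian differential categories -/

/-- A (`k`-linear) cartesian differential structure on a cartesian left-`k`-linear category. -/
class CartesianDifferential (k : Type w) [CommSemiring k] (C : Type u) [Category.{v} C]
    [CartesianMonoidalCategory C] [LeftAdditive C] [LeftLinear k C]
    [CartesianLeftLinear k C] where
  /-- The differential operator. -/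
  D : ∀ {A B : C}, (A ⟶ B) → (A ⊗ A ⟶ B)
  D_add : ∀ {A B : C} (f g : A ⟶ B), D (f + g) = D f + D g
  D_smul : ∀ {A B : C} (r : k) (f : A ⟶ B), D (r • f) = r • D f
  lift_add_D : ∀ {Z A B : C} (f : A ⟶ B) (x v w : Z ⟶ A),
    lift x (v + w) ≫ D f = lift x v ≫ D f + lift x w ≫ D f
  lift_smul_D : ∀ {Z A B : C} (f : A ⟶ B) (r : k) (x v : Z ⟶ A),
    lift x (r • v) ≫ D f = r • (lift x v ≫ D f)
  D_fst : ∀ A B : C, D (fst A B) = snd (A ⊗ B) (A ⊗ B) ≫ fst A B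
  D_snd : ∀ A B : C, D (snd A B) = snd (A ⊗ B) (A ⊗ B) ≫ snd A B
  D_id : ∀ A : C, D (𝟙 A) = snd A A
  D_comp : ∀ {A B E : C} (f : A ⟶ B) (g : B ⟶ E),
    D (f ≫ g) = lift (fst A A ≫ f) (D f) ≫ D g
  D_D_linear : ∀ {Z A B : C} (f : A ⟶ B) (x r v : Z ⟶ A),
    lift (lift x r) (lift 0 v) ≫ D (D f) = lift x v ≫ D f
  D_D_symm : ∀ {Z A B : C} (f : A ⟶ B) (x r s : Z ⟶ A),
    lift (lift x r) (lift s 0) ≫ D (D f) = lift (lift x s) (lift r 0) ≫ D (D f)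

/-! ### Strict structure-preserving functors -/

/-- A strict map of cartesian left-`k`-linear categories: a functor preserving the `k`-module
structure of the hom-sets and, on the nose, the chosen finite products. -/
@[ext]
structure CartLinFunctor (k : Type w) [CommSemiring k]
    (C : Type u₁) [Category.{v₁} C] [CartesianMonoidalCategory C] [LeftAdditive C]
    [LeftLinear k C]
    (E : Type u₂) [Category.{v₂} E] [CartesianMonoidalCategory E] [LeftAdditive E]
    [LeftLinear k E] extends C ⥤ E where
  map_add : ∀ {X Y : C} (f g : X ⟶ Y), map (f + g) = map f + map g
  map_smul : ∀ {X Y : C} (r : k) (f : X ⟶ Y), map (r • f) = r • map f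
  obj_unit : obj (𝟙_ C) = 𝟙_ E
  obj_tensor : ∀ X Y : C, obj (X ⊗ Y) = obj X ⊗ obj Y
  map_fst : ∀ X Y : C, map (fst X Y) = eqToHom (obj_tensor X Y) ≫ fst (obj X) (obj Y)
  map_snd : ∀ X Y : C, map (snd X Y) = eqToHom (obj_tensor X Y) ≫ snd (obj X) (obj Y)

/-- A strict map of cartesian differential categories: a strict map of the underlying cartesian
left-`k`-linear categories which commutes with the differential operators. -/
@[ext]
structure CartDiffFunctor (k : Type w) [CommSemiring k]
    (C : Type u₁) [Category.{v₁} C] [CartesianMonoidalCategory C] [LeftAdditive C]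
    [LeftLinear k C] [CartesianLeftLinear k C] [CartesianDifferential k C]
    (E : Type u₂) [Category.{v₂} E] [CartesianMonoidalCategory E] [LeftAdditive E]
    [LeftLinear k E] [CartesianLeftLinear k E] [CartesianDifferential k E]
    extends CartLinFunctor k C E where
  map_D : ∀ {X Y : C} (f : X ⟶ Y),
    map (CartesianDifferential.D k f) =
      eqToHom (obj_tensor X X) ≫ CartesianDifferential.D k (map f)

namespace CartLinFunctor

variable (k : Type w) [CommSemiring k]
    (C : Type u₁) [Category.{v₁} C] [CartesianMonoidalCategory C] [LeftAdditive C]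
    [LeftLinear k C]
    {E : Type u₂} [Category.{v₂} E] [CartesianMonoidalCategory E] [LeftAdditive E]
    [LeftLinear k E]
    {G : Type u₃} [Category.{v₃} G] [CartesianMonoidalCategory G] [LeftAdditive G]
    [LeftLinear k G]

/-- The identity strict map. -/
def id : CartLinFunctor k C C where
  toFunctor := 𝟭 C
  map_add _ _ := rfl
  map_smul _ _ := rfl
  obj_unit := rfl
  obj_tensor _ _ := rfl
  map_fst _ _ := by simp
  map_snd _ _ := by simp

variable {k C}

/-- Composition of strict maps, in diagrammatic order. -/
def comp (F : CartLinFunctor k C E) (F' : CartLinFunctor k E G) : CartLinFunctor k C G where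
  toFunctor := F.toFunctor ⋙ F'.toFunctor
  map_add f g := by simp [F.map_add, F'.map_add]
  map_smul r f := by simp [F.map_smul, F'.map_smul]
  obj_unit := (congrArg F'.obj F.obj_unit).trans F'.obj_unit
  obj_tensor X Y := (congrArg F'.obj (F.obj_tensor X Y)).trans (F'.obj_tensor _ _)
  map_fst X Y := by simp [F.map_fst, F'.map_fst, eqToHom_map]
  map_snd X Y := by simp [F.map_snd, F'.map_snd, eqToHom_map]

end CartLinFunctor

namespace CartDiffFunctor

variable (k : Type w) [CommSemiring k]
    (C : Type u₁) [Category.{v₁} C] [CartesianMonoidalCategory C] [LeftAdditive C]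
    [LeftLinear k C] [CartesianLeftLinear k C] [CartesianDifferential k C]
    {E : Type u₂} [Category.{v₂} E] [CartesianMonoidalCategory E] [LeftAdditive E]
    [LeftLinear k E] [CartesianLeftLinear k E] [CartesianDifferential k E]
    {G : Type u₃} [Category.{v₃} G] [CartesianMonoidalCategory G] [LeftAdditive G]
    [LeftLinear k G] [CartesianLeftLinear k G] [CartesianDifferential k G]

/-- The identity strict map. -/
def id : CartDiffFunctor k C C where
  toCartLinFunctor := CartLinFunctor.id k C
  map_D _ := (Category.id_comp _).symm

variable {k C}

/-- Composition of strict maps, in diagrammatic order. -/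
def comp (F : CartDiffFunctor k C E) (F' : CartDiffFunctor k E G) : CartDiffFunctor k C G where
  toCartLinFunctor := F.toCartLinFunctor.comp F'.toCartLinFunctor
  map_D f := by simp [CartLinFunctor.comp, F.map_D, F'.map_D, eqToHom_map]

end CartDiffFunctor

/-! ### The categories of cartesian left-`k`-linear and of cartesian differential categories -/

/-- A bundled cartesian left-`k`-linear category. -/
structure CartLinCat (k : Type w) [CommSemiring k] where
  carrier : Type u
  [category : Category.{v} carrier]
  [cartesian : CartesianMonoidalCategory carrier]
  [leftAdditive : LeftAdditive carrier]
  [leftLinear : LeftLinear k carrier]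
  [cartesianLeftLinear : CartesianLeftLinear k carrier]

attribute [instance] CartLinCat.category CartLinCat.cartesian CartLinCat.leftAdditive
  CartLinCat.leftLinear CartLinCat.cartesianLeftLinear

/-- A bundled cartesian differential category. -/
structure CartDiffCat (k : Type w) [CommSemiring k] extends CartLinCat.{w, v, u} k where
  [differential : CartesianDifferential k carrier]

attribute [instance] CartDiffCat.differential

/-- Cartesian left-`k`-linear categories and strict maps. -/
instance CartLinCat.instCategory (k : Type w) [CommSemiring k] :
    Category (CartLinCat.{w, v, u} k) where
  Hom A B := CartLinFunctor k A.carrier B.carrier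
  id A := CartLinFunctor.id k A.carrier
  comp F G := F.comp G

/-- Cartesian differential categories and strict maps. -/
instance CartDiffCat.instCategory (k : Type w) [CommSemiring k] :
    Category (CartDiffCat.{w, v, u} k) where
  Hom A B := CartDiffFunctor k A.carrier B.carrier
  id A := CartDiffFunctor.id k A.carrier
  comp F G := F.comp G

/-- The functor forgetting the differential operators. -/
def CartDiffCat.forget (k : Type w) [CommSemiring k] :
    CartDiffCat.{w, v, u} k ⥤ CartLinCat.{w, v, u} k where
  obj A := A.toCartLinCat
  map F := F.toCartLinFunctor

/-! ### Symmetric multilinear families -/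

namespace FaaDiBruno

section Power

variable {C : Type u} [Category.{v} C] [CartesianMonoidalCategory C]

/-- The power `X ^ n`. -/
def power (X : C) : ℕ → C
  | 0 => 𝟙_ C
  | n + 1 => X ⊗ power X n

/-- The projections of the power `X ^ n`. -/
def proj (X : C) : ∀ n : ℕ, Fin n → (power X n ⟶ X)
  | 0 => fun i => i.elim0
  | n + 1 => Fin.cases (fst X (power X n)) fun i => snd X (power X n) ≫ proj X n i

/-- The map into a power with given components. -/
def tuple {Z X : C} : ∀ {n : ℕ}, (Fin n → (Z ⟶ X)) → (Z ⟶ power X n)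
  | 0, _ => toUnit Z
  | n + 1, v => lift (v 0) (tuple fun i : Fin n => v i.succ)

@[simp]
theorem tuple_proj {Z X : C} : ∀ {n : ℕ} (v : Fin n → (Z ⟶ X)) (i : Fin n),
    tuple v ≫ proj X n i = v i
  | n + 1, v, i => by
    induction i using Fin.cases with
    | zero => exact lift_fst _ _
    | succ i =>
      change lift (v 0) (tuple fun i : Fin n => v i.succ) ≫ snd X (power X n) ≫ proj X n i = _
      rw [lift_snd_assoc, tuple_proj]

@[simp]
theorem tuple_proj_assoc {Z X Y : C} {n : ℕ} (v : Fin n → (Z ⟶ X)) (i : Fin n) (h : X ⟶ Y) :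
    tuple v ≫ proj X n i ≫ h = v i ≫ h := by
  rw [← Category.assoc, tuple_proj]

theorem power_hom_ext {Z X : C} : ∀ {n : ℕ} (f g : Z ⟶ power X n),
    (∀ i, f ≫ proj X n i = g ≫ proj X n i) → f = g
  | 0, f, g, _ => toUnit_unique (C := C) f g
  | n + 1, f, g, h => by
    refine CartesianMonoidalCategory.hom_ext (Y := power X n) f g (h 0) ?_
    refine power_hom_ext _ _ fun i => ?_
    exact (@Category.assoc C _ Z (X ⊗ power X n) _ _ f (snd X (power X n)) (proj X n i)).trans
      ((h i.succ).trans
        (@Category.assoc C _ Z (X ⊗ power X n) _ _ g (snd X (power X n)) (proj X n i)).symm)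

theorem comp_tuple {W Z X : C} (h : W ⟶ Z) {n : ℕ} (v : Fin n → (Z ⟶ X)) :
    h ≫ tuple v = tuple fun i => h ≫ v i :=
  power_hom_ext _ _ fun i => by simp

theorem tuple_comp_proj {Z X : C} {n : ℕ} (f : Z ⟶ power X n) :
    (tuple fun i => f ≫ proj X n i) = f :=
  power_hom_ext _ _ fun i => by simp

/-- `f (x, v₁, …, vₙ)` for a map `f : X × Xⁿ ⟶ Y` and generalized elements `x, vᵢ` of `X`. -/
def app {n : ℕ} {Z X Y : C} (f : X ⊗ power X n ⟶ Y) (x : Z ⟶ X) (v : Fin n → (Z ⟶ X)) : Z ⟶ Y :=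
  lift x (tuple v) ≫ f

theorem app_ext {n : ℕ} {X Y : C} {f g : X ⊗ power X n ⟶ Y}
    (h : app f (fst X (power X n)) (fun i => snd X (power X n) ≫ proj X n i) =
      app g (fst X (power X n)) (fun i => snd X (power X n) ≫ proj X n i)) : f = g := by
  simpa [app, tuple_comp_proj] using h

theorem comp_app {n : ℕ} {W Z X Y : C} (h : W ⟶ Z) (f : X ⊗ power X n ⟶ Y) (x : Z ⟶ X)
    (v : Fin n → (Z ⟶ X)) : h ≫ app f x v = app f (h ≫ x) fun i => h ≫ v i := by
  rw [app, app, ← comp_tuple, ← comp_lift, Category.assoc]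

end Power

section Families

variable (k : Type w) [CommSemiring k] {C : Type u} [Category.{v} C]
  [CartesianMonoidalCategory C] [LeftAdditive C] [LeftLinear k C]

/-- A Faà di Bruno morphism from `X` to `Y`: a family of maps `f⁽ⁿ⁾ : X × Xⁿ ⟶ Y` for `n : ℕ`,
each of which is symmetric and `k`-linear in each of its last `n` variables. -/
@[ext]
structure Hom (X Y : C) where
  /-- The component `f⁽ⁿ⁾`. -/
  comp : ∀ n : ℕ, X ⊗ power X n ⟶ Y
  symm : ∀ {n : ℕ} {Z : C} (x : Z ⟶ X) (v : Fin n → (Z ⟶ X)) (σ : Equiv.Perm (Fin n)),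
    app (comp n) x (v ∘ σ) = app (comp n) x v
  map_add : ∀ {n : ℕ} {Z : C} (x : Z ⟶ X) (v : Fin n → (Z ⟶ X)) (i : Fin n) (a b : Z ⟶ X),
    app (comp n) x (Function.update v i (a + b)) =
      app (comp n) x (Function.update v i a) + app (comp n) x (Function.update v i b)
  map_smul : ∀ {n : ℕ} {Z : C} (x : Z ⟶ X) (v : Fin n → (Z ⟶ X)) (i : Fin n) (r : k) (a : Z ⟶ X),
    app (comp n) x (Function.update v i (r • a)) = r • app (comp n) x (Function.update v i a)

end Families

namespace Hom

variable {k : Type w} [CommSemiring k] {C : Type u} [Category.{v} C]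
  [CartesianMonoidalCategory C] [LeftAdditive C] [LeftLinear k C]

/-- `f⁽ⁿ⁾ (x, (vᵢ)ᵢ)` for a finite family `v` with `n` members, taken in any order: the order
is immaterial since `f⁽ⁿ⁾` is symmetric. -/
noncomputable def eval {X Y Z : C} (f : Hom k X Y) {ι : Type*} [Finite ι] (x : Z ⟶ X)
    (v : ι → (Z ⟶ X)) : Z ⟶ Y :=
  app (f.comp (Nat.card ι)) x (v ∘ (Finite.equivFin ι).symm)

variable {X Y Z W T : C}

theorem eval_eq_app (f : Hom k X Y) {ι : Type*} [Finite ι] {n : ℕ} (e : Fin n ≃ ι)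
    (x : Z ⟶ X) (v : ι → (Z ⟶ X)) : f.eval x v = app (f.comp n) x (v ∘ e) := by
  obtain rfl : n = Nat.card ι := by simpa using Nat.card_congr e
  have := f.symm x (v ∘ e) ((Finite.equivFin ι).symm.trans e.symm)
  rw [← this, eval]
  congr 1
  ext i
  simp

@[simp]
theorem eval_fin (f : Hom k X Y) {n : ℕ} (x : Z ⟶ X) (v : Fin n → (Z ⟶ X)) :
    f.eval x v = app (f.comp n) x v :=
  f.eval_eq_app (Equiv.refl _) x v

theorem eval_equiv (f : Hom k X Y) {ι κ : Type*} [Finite ι] [Finite κ] (e : ι ≃ κ)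
    (x : Z ⟶ X) (v : κ → (Z ⟶ X)) : f.eval x (v ∘ e) = f.eval x v := by
  rw [f.eval_eq_app (Finite.equivFin ι).symm, f.eval_eq_app ((Finite.equivFin ι).symm.trans e)]
  rfl

theorem eval_congr (f : Hom k X Y) {ι κ : Type*} [Finite ι] [Finite κ] (e : ι ≃ κ)
    (x : Z ⟶ X) (u : ι → (Z ⟶ X)) (v : κ → (Z ⟶ X)) (h : ∀ i, u i = v (e i)) :
    f.eval x u = f.eval x v := by
  rw [← f.eval_equiv e]
  exact congrArg _ (funext h)

theorem comp_eval (h : W ⟶ Z) (f : Hom k X Y) {ι : Type*} [Finite ι] (x : Z ⟶ X)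
    (v : ι → (Z ⟶ X)) : h ≫ f.eval x v = f.eval (h ≫ x) fun i => h ≫ v i :=
  comp_app _ _ _ _

theorem eval_update_add (f : Hom k X Y) {ι : Type*} [Finite ι] [DecidableEq ι] (x : Z ⟶ X)
    (v : ι → (Z ⟶ X)) (i : ι) (a b : Z ⟶ X) :
    f.eval x (Function.update v i (a + b)) =
      f.eval x (Function.update v i a) + f.eval x (Function.update v i b) := by
  simp only [f.eval_eq_app (Finite.equivFin ι).symm, Function.update_comp_equiv]
  exact f.map_add _ _ _ _ _

theorem eval_update_smul (f : Hom k X Y) {ι : Type*} [Finite ι] [DecidableEq ι] (x : Z ⟶ X)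
    (v : ι → (Z ⟶ X)) (i : ι) (r : k) (a : Z ⟶ X) :
    f.eval x (Function.update v i (r • a)) = r • f.eval x (Function.update v i a) := by
  simp only [f.eval_eq_app (Finite.equivFin ι).symm, Function.update_comp_equiv]
  exact f.map_smul _ _ _ _ _

theorem eval_update_zero (f : Hom k X Y) {ι : Type*} [Finite ι] [DecidableEq ι] (x : Z ⟶ X)
    (v : ι → (Z ⟶ X)) (i : ι) : f.eval x (Function.update v i 0) = 0 := by
  simpa using f.eval_update_smul x v i 0 0

theorem eval_eq_zero (f : Hom k X Y) {ι : Type*} [Finite ι] (x : Z ⟶ X)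
    (v : ι → (Z ⟶ X)) (i : ι) (h : v i = 0) : f.eval x v = 0 := by
  classical
  rw [← f.eval_update_zero x v i, ← h, Function.update_eq_self]

theorem eval_update_sum (f : Hom k X Y) {ι κ : Type*} [Finite ι] [DecidableEq ι] (s : Finset κ)
    (x : Z ⟶ X) (v : ι → (Z ⟶ X)) (i : ι) (a : κ → (Z ⟶ X)) :
    f.eval x (Function.update v i (∑ j ∈ s, a j)) =
      ∑ j ∈ s, f.eval x (Function.update v i (a j)) := by
  classical
  induction s using Finset.induction_on with
  | empty => simpa using f.eval_update_zero x v i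
  | insert j s hj ih => rw [Finset.sum_insert hj, Finset.sum_insert hj, eval_update_add, ih]

theorem ext_fin {f g : Hom k X Y}
    (h : ∀ (n : ℕ) (Z : C) (x : Z ⟶ X) (v : Fin n → (Z ⟶ X)), f.eval x v = g.eval x v) :
    f = g := by
  ext n
  have := h n _ (fst X (power X n)) (fun i => snd X (power X n) ≫ proj X n i)
  rw [eval_fin, eval_fin] at this
  exact app_ext this

end Hom

/-! ### Composition -/

theorem comp_sum {C : Type u} [Category.{v} C] [LeftAdditive C] {X Y Z : C} {ι : Type*}
    (s : Finset ι) (f : X ⟶ Y) (g : ι → (Y ⟶ Z)) :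
    f ≫ ∑ i ∈ s, g i = ∑ i ∈ s, f ≫ g i := by
  classical
  induction s using Finset.induction_on with
  | empty => simpa using LeftAdditive.comp_zero f Z
  | insert j s hj ih => rw [Finset.sum_insert hj, Finset.sum_insert hj, LeftAdditive.comp_add, ih]

noncomputable instance fintypeSetoid (ι : Type*) [Finite ι] : Fintype (Setoid ι) :=
  haveI : Finite (Setoid ι) :=
    Finite.of_injective (fun s : Setoid ι => fun a b => s a b) fun s t h => by
      ext a b
      exact iff_of_eq (congrFun (congrFun h a) b)
  Fintype.ofFinite _

/-- The block `q` of a partition `s` of `ι`. Partitions of `ι` into non-empty blocks are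
represented by equivalence relations; `Quotient s` is the set of blocks. -/
abbrev Block {ι : Type*} (s : Setoid ι) (q : Quotient s) : Type _ := {i : ι // Quotient.mk s i = q}

section Composition

variable {k : Type w} [CommSemiring k] {C : Type u} [Category.{v} C]
  [CartesianMonoidalCategory C] [LeftAdditive C] [LeftLinear k C] {X Y T Z W : C}

/-- The right-hand side of the higher-order chain rule, evaluated at a finite family `v`:
the sum, over all partitions of `ι` into non-empty blocks `A₁, …, Aₘ`, of
`g⁽ᵐ⁾ (f⁽⁰⁾ x, f (x, v|A₁), …, f (x, v|Aₘ))`. -/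
noncomputable def chain (f : Hom k X Y) (g : Hom k Y T) {ι : Type*} [Finite ι] (x : Z ⟶ X)
    (v : ι → (Z ⟶ X)) : Z ⟶ T :=
  ∑ s : Setoid ι, g.eval (f.eval x (Fin.elim0 : Fin 0 → (Z ⟶ X)))
    fun q : Quotient s => f.eval x fun i : Block s q => v i

theorem comp_chain (h : W ⟶ Z) (f : Hom k X Y) (g : Hom k Y T) {ι : Type*} [Finite ι]
    (x : Z ⟶ X) (v : ι → (Z ⟶ X)) :
    h ≫ chain f g x v = chain f g (h ≫ x) fun i => h ≫ v i := by
  simp only [chain, comp_sum, Hom.comp_eval]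
  congr! with s hs

/-- Transport of partitions along a bijection. -/
def setoidEquiv {ι κ : Type*} (e : ι ≃ κ) : Setoid κ ≃ Setoid ι where
  toFun s := s.comap e
  invFun s := s.comap e.symm
  left_inv s := by ext a b; simp [Setoid.comap_rel]
  right_inv s := by ext a b; simp [Setoid.comap_rel]

theorem chain_equiv (f : Hom k X Y) (g : Hom k Y T) {ι κ : Type*} [Finite ι] [Finite κ]
    (e : ι ≃ κ) (x : Z ⟶ X) (v : κ → (Z ⟶ X)) : chain f g x (v ∘ e) = chain f g x v := by
  refine (Fintype.sum_equiv (setoidEquiv e) _ _ fun s => ?_).symm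
  let E : Quotient (setoidEquiv e s) ≃ Quotient s :=
    Quotient.congr e fun a b => Iff.rfl
  refine (g.eval_congr E _ _ _ fun q => ?_).symm
  let E' : Block (setoidEquiv e s) q ≃ Block s (E q) :=
    e.subtypeEquiv fun a => by
      change _ ↔ E (Quotient.mk _ a) = E q
      simp
  exact f.eval_congr E' _ _ _ fun i => rfl

theorem chain_update {ι : Type*} [Finite ι] [DecidableEq ι] (f : Hom k X Y) (s : Setoid ι)
    [DecidableEq (Quotient s)] (x : Z ⟶ X) (v : ι → (Z ⟶ X)) (i : ι) (a : Z ⟶ X) :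
    (fun q : Quotient s => f.eval x fun j : Block s q => Function.update v i a j) =
      Function.update (fun q : Quotient s => f.eval x fun j : Block s q => v j) (Quotient.mk s i)
        (f.eval x (Function.update (fun j : Block s (Quotient.mk s i) => v j) ⟨i, rfl⟩ a)) := by
  funext q
  by_cases hq : q = Quotient.mk s i
  · subst hq
    rw [Function.update_self]
    congr 1
    funext j
    simp only [Function.update_apply, Subtype.ext_iff]
  · rw [Function.update_of_ne hq]
    congr 1
    funext j
    refine Function.update_of_ne ?_ _ _
    rintro h
    exact hq (by rw [← h]; exact j.2.symm)

theorem chain_update_add (f : Hom k X Y) (g : Hom k Y T) {ι : Type*} [Finite ι] [DecidableEq ι]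
    (x : Z ⟶ X) (v : ι → (Z ⟶ X)) (i : ι) (a b : Z ⟶ X) :
    chain f g x (Function.update v i (a + b)) =
      chain f g x (Function.update v i a) + chain f g x (Function.update v i b) := by
  classical
  simp only [chain, chain_update, Hom.eval_update_add, Finset.sum_add_distrib]

theorem chain_update_smul (f : Hom k X Y) (g : Hom k Y T) {ι : Type*} [Finite ι] [DecidableEq ι]
    (x : Z ⟶ X) (v : ι → (Z ⟶ X)) (i : ι) (r : k) (a : Z ⟶ X) :
    chain f g x (Function.update v i (r • a)) = r • chain f g x (Function.update v i a) := by
  classical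
  simp only [chain, chain_update, Hom.eval_update_smul, Finset.smul_sum]

theorem app_chain (f : Hom k X Y) (g : Hom k Y T) {n : ℕ} (x : Z ⟶ X) (v : Fin n → (Z ⟶ X)) :
    app (chain f g (fst X (power X n)) fun i => snd X (power X n) ≫ proj X n i) x v =
      chain f g x v := by
  rw [app, comp_chain]
  simp

/-- Composition of Faà di Bruno morphisms, in diagrammatic order, by the higher-order chain rule:
the composite of `f` and `g` has `n`-th component
`∑ g⁽ᵐ⁾ (f⁽⁰⁾ x₀, f⁽|A₁|⁾ (x₀, (xᵢ)_{i ∈ A₁}), …, f⁽|Aₘ|⁾ (x₀, (xᵢ)_{i ∈ Aₘ}))`, the sum being over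
the partitions of the set of the last `n` variables into non-empty blocks `A₁, …, Aₘ`. -/
noncomputable def Hom.then (f : Hom k X Y) (g : Hom k Y T) : Hom k X T where
  comp n := chain f g (fst X (power X n)) fun i => snd X (power X n) ≫ proj X n i
  symm x v σ := by simpa only [app_chain] using chain_equiv f g σ x v
  map_add x v i a b := by simpa only [app_chain] using chain_update_add f g x v i a b
  map_smul x v i r a := by simpa only [app_chain] using chain_update_smul f g x v i r a

theorem Hom.then_eval (f : Hom k X Y) (g : Hom k Y T) {ι : Type*} [Finite ι] (x : Z ⟶ X)
    (v : ι → (Z ⟶ X)) : (f.then g).eval x v = chain f g x v := by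
  rw [← Hom.eval_equiv _ (Finite.equivFin ι).symm, ← chain_equiv _ _ (Finite.equivFin ι).symm,
    eval_fin]
  exact app_chain _ _ _ _

end Composition

/-! ### Linear maps, pairing, identities -/

section Structure

variable {k : Type w} [CommSemiring k] {C : Type u} [Category.{v} C]
  [CartesianMonoidalCategory C] [LeftAdditive C] [LeftLinear k C] {X Y T Z W : C}

variable (k) in
/-- `k`-linear maps. -/
structure IsLinear (p : X ⟶ Y) : Prop where
  add : ∀ {Z : C} (a b : Z ⟶ X), (a + b) ≫ p = a ≫ p + b ≫ p
  smul : ∀ {Z : C} (r : k) (a : Z ⟶ X), (r • a) ≫ p = r • (a ≫ p)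

theorem IsLinear.zero {p : X ⟶ Y} (hp : IsLinear k p) (Z : C) : (0 : Z ⟶ X) ≫ p = 0 := by
  simpa using hp.smul (0 : k) (0 : Z ⟶ X)

theorem IsLinear.sum {p : X ⟶ Y} (hp : IsLinear k p) {ι : Type*} (s : Finset ι)
    (a : ι → (Z ⟶ X)) : (∑ i ∈ s, a i) ≫ p = ∑ i ∈ s, a i ≫ p := by
  classical
  induction s using Finset.induction_on with
  | empty => simpa using hp.zero Z
  | insert j s hj ih => rw [Finset.sum_insert hj, Finset.sum_insert hj, hp.add, ih]

variable (k) in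
theorem isLinear_id (X : C) : IsLinear k (𝟙 X) := ⟨by simp, by simp⟩

theorem IsLinear.comp {p : X ⟶ Y} {q : Y ⟶ T} (hp : IsLinear k p) (hq : IsLinear k q) :
    IsLinear k (p ≫ q) :=
  ⟨fun a b => by rw [← Category.assoc, hp.add, hq.add, Category.assoc, Category.assoc],
    fun r a => by rw [← Category.assoc, hp.smul, hq.smul, Category.assoc]⟩

/-- The components `p⁽⁰⁾ = p`, `p⁽¹⁾ = p π₁` and `p⁽ⁿ⁾ = 0` for `n ≥ 2` associated to a map `p`. -/
def linComp (p : X ⟶ Y) : ∀ n : ℕ, X ⊗ power X n ⟶ Y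
  | 0 => fst X (power X 0) ≫ p
  | 1 => (snd X (power X 1) ≫ proj X 1 0) ≫ p
  | _ + 2 => 0

@[simp] theorem app_linComp_zero (p : X ⟶ Y) (x : Z ⟶ X) (v : Fin 0 → (Z ⟶ X)) :
    app (linComp p 0) x v = x ≫ p := by simp [app, linComp]

@[simp] theorem app_linComp_one (p : X ⟶ Y) (x : Z ⟶ X) (v : Fin 1 → (Z ⟶ X)) :
    app (linComp p 1) x v = v 0 ≫ p := by
  rw [app, linComp, ← Category.assoc, ← Category.assoc, lift_snd, tuple_proj]

@[simp] theorem app_linComp_add_two (p : X ⟶ Y) {n : ℕ} (x : Z ⟶ X) (v : Fin (n + 2) → (Z ⟶ X)) :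
    app (linComp p (n + 2)) x v = 0 := LeftAdditive.comp_zero _ _

/-- The Faà di Bruno morphism associated to a `k`-linear map `p`. -/
def Hom.lin (p : X ⟶ Y) (hp : IsLinear k p) : Hom k X Y where
  comp := linComp p
  symm {n} _ x v σ := by
    match n with
    | 0 => simp
    | 1 => simp [Subsingleton.elim σ 1]
    | n + 2 => simp
  map_add {n} _ x v i a b := by
    match n with
    | 0 => exact i.elim0
    | 1 => simp [Subsingleton.elim i 0, hp.add]
    | n + 2 => simp
  map_smul {n} _ x v i r a := by
    match n with
    | 0 => exact i.elim0
    | 1 => simp [Subsingleton.elim i 0, hp.smul]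
    | n + 2 => simp

/-- The identity Faà di Bruno morphism: `id⁽⁰⁾ = id`, `id⁽¹⁾ = π₁` and `id⁽ⁿ⁾ = 0` for `n ≥ 2`. -/
def Hom.id (X : C) : Hom k X X := Hom.lin (𝟙 X) (isLinear_id k X)

/-- The `k`-linear map `p` applied to all the components of `f`. -/
def Hom.post (f : Hom k X Y) (p : Y ⟶ T) (hp : IsLinear k p) : Hom k X T where
  comp n := f.comp n ≫ p
  symm x v σ := by
    simpa only [app, Category.assoc] using congrArg (· ≫ p) (f.symm x v σ)
  map_add x v i a b := by
    simpa only [app, Category.assoc, hp.add] using congrArg (· ≫ p) (f.map_add x v i a b)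
  map_smul x v i r a := by
    simpa only [app, Category.assoc, hp.smul] using congrArg (· ≫ p) (f.map_smul x v i r a)

theorem Hom.post_eval (f : Hom k X Y) (p : Y ⟶ T) (hp : IsLinear k p) {ι : Type*} [Finite ι]
    (x : Z ⟶ X) (v : ι → (Z ⟶ X)) : (f.post p hp).eval x v = f.eval x v ≫ p := by
  simp [eval, app, post]

instance : Zero (Hom k X Y) where
  zero :=
    { comp := fun _ => 0
      symm := fun _ _ _ => by simp [app, LeftAdditive.comp_zero]
      map_add := fun _ _ _ _ _ => by simp [app, LeftAdditive.comp_zero]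
      map_smul := fun _ _ _ _ _ => by simp [app, LeftAdditive.comp_zero] }

instance : Add (Hom k X Y) where
  add f g :=
    { comp := fun n => f.comp n + g.comp n
      symm := fun x v σ => by
        have := f.symm x v σ
        have := g.symm x v σ
        simp_all [app, LeftAdditive.comp_add]
      map_add := fun x v i a b => by
        have := f.map_add x v i a b
        have := g.map_add x v i a b
        simp_all only [app, LeftAdditive.comp_add]
        abel
      map_smul := fun x v i r a => by
        have := f.map_smul x v i r a
        have := g.map_smul x v i r a
        simp_all only [app, LeftAdditive.comp_add, smul_add] }

instance : SMul k (Hom k X Y) where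
  smul t f :=
    { comp := fun n => t • f.comp n
      symm := fun x v σ => by
        have := f.symm x v σ
        simp_all [app, LeftLinear.comp_smul]
      map_add := fun x v i a b => by
        have := f.map_add x v i a b
        simp_all only [app, LeftLinear.comp_smul, smul_add]
      map_smul := fun x v i r a => by
        have := f.map_smul x v i r a
        simp_all only [app, LeftLinear.comp_smul]
        rw [smul_comm] }

namespace Hom

instance : AddCommMonoid (Hom k X Y) where
  add_assoc f g h := by ext n; exact add_assoc _ _ _
  zero_add f := by ext n; exact zero_add _
  add_zero f := by ext n; exact add_zero _
  add_comm f g := by ext n; exact add_comm _ _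
  nsmul := nsmulRec

instance : Module k (Hom k X Y) where
  one_smul f := by ext n; exact one_smul _ _
  mul_smul r s f := by ext n; exact mul_smul _ _ _
  smul_zero r := by ext n; exact smul_zero _
  smul_add r f g := by ext n; exact smul_add _ _ _
  add_smul r s f := by ext n; exact add_smul _ _ _
  zero_smul f := by ext n; exact zero_smul _ _

section

variable {ι : Type*} [Finite ι] (x : Z ⟶ X) (v : ι → (Z ⟶ X))

theorem zero_eval : (0 : Hom k X Y).eval x v = 0 := LeftAdditive.comp_zero _ _

theorem add_eval (f g : Hom k X Y) : (f + g).eval x v = f.eval x v + g.eval x v :=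
  LeftAdditive.comp_add _ _ _

theorem smul_eval (r : k) (f : Hom k X Y) : (r • f).eval x v = r • f.eval x v :=
  LeftLinear.comp_smul _ _ _

end

end Hom

end Structure

theorem lift_add (k : Type w) [CommSemiring k] {C : Type u} [Category.{v} C]
    [CartesianMonoidalCategory C] [LeftAdditive C] [LeftLinear k C] [CartesianLeftLinear k C]
    {X Y Z : C} (a a' : Z ⟶ X) (b b' : Z ⟶ Y) :
    lift (a + a') (b + b') = lift a b + lift a' b' := by
  ext
  · simp [CartesianLeftLinear.add_fst k]
  · simp [CartesianLeftLinear.add_snd k]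

section Cartesian

variable {k : Type w} [CommSemiring k] {C : Type u} [Category.{v} C]
  [CartesianMonoidalCategory C] [LeftAdditive C] [LeftLinear k C] [CartesianLeftLinear k C]
  {X Y T Z W V : C}

variable (k) in
theorem isLinear_fst (X Y : C) : IsLinear k (fst X Y) :=
  ⟨CartesianLeftLinear.add_fst k, CartesianLeftLinear.smul_fst⟩

variable (k) in
theorem isLinear_snd (X Y : C) : IsLinear k (snd X Y) :=
  ⟨CartesianLeftLinear.add_snd k, CartesianLeftLinear.smul_snd⟩

theorem lift_smul (r : k) (a : Z ⟶ X) (b : Z ⟶ Y) : lift (r • a) (r • b) = r • lift a b := by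
  ext
  · simp [CartesianLeftLinear.smul_fst]
  · simp [CartesianLeftLinear.smul_snd]

/-- The pairing of Faà di Bruno morphisms. -/
def Hom.pair (f : Hom k X Y) (g : Hom k X T) : Hom k X (Y ⊗ T) where
  comp n := lift (f.comp n) (g.comp n)
  symm x v σ := by
    have := f.symm x v σ
    have := g.symm x v σ
    simp_all only [app, comp_lift]
  map_add x v i a b := by
    have := f.map_add x v i a b
    have := g.map_add x v i a b
    simp_all only [app, comp_lift, lift_add k]
  map_smul x v i r a := by
    have := f.map_smul x v i r a
    have := g.map_smul x v i r a
    simp_all only [app, comp_lift, lift_smul]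

theorem Hom.pair_eval (f : Hom k X Y) (g : Hom k X T) {ι : Type*} [Finite ι] (x : Z ⟶ X)
    (v : ι → (Z ⟶ X)) : (f.pair g).eval x v = lift (f.eval x v) (g.eval x v) := by
  simp [eval, app, pair]

/-! ### The differential operator -/

open Classical in
/-- The value of `D f` at `(x, y)` and the family of the `(uᵢ, vᵢ)`:
`f (x, u, y) + ∑ i, f (x, u[vᵢ / uᵢ])`. -/
noncomputable def diff (f : Hom k X Y) {ι : Type*} [Finite ι] (x y : Z ⟶ X) (u v : ι → (Z ⟶ X)) :
    Z ⟶ Y :=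
  letI := Fintype.ofFinite ι
  f.eval x (fun o : Option ι => o.elim y u) + ∑ i : ι, f.eval x (Function.update u i (v i))

theorem diff_eq (f : Hom k X Y) {ι : Type*} [Fintype ι] [DecidableEq ι] (x y : Z ⟶ X) (u v : ι → (Z ⟶ X)) :
    diff f x y u v =
      f.eval x (fun o : Option ι => o.elim y u) + ∑ i : ι, f.eval x (Function.update u i (v i)) := by
  rw [diff]
  congr!

theorem comp_diff (h : W ⟶ Z) (f : Hom k X Y) {ι : Type*} [Finite ι] (x y : Z ⟶ X)
    (u v : ι → (Z ⟶ X)) :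
    h ≫ diff f x y u v = diff f (h ≫ x) (h ≫ y) (fun i => h ≫ u i) fun i => h ≫ v i := by
  classical
  rw [diff, diff, LeftAdditive.comp_add, comp_sum, Hom.comp_eval]
  congr 1
  · congr 1
    funext o
    cases o <;> rfl
  · refine Finset.sum_congr rfl fun i _ => ?_
    rw [Hom.comp_eval]
    congr 1
    funext j
    simp only [Function.update_apply]
    split_ifs <;> rfl

theorem diff_equiv (f : Hom k X Y) {ι κ : Type*} [Finite ι] [Finite κ] (e : ι ≃ κ)
    (x y : Z ⟶ X) (u v : κ → (Z ⟶ X)) : diff f x y (u ∘ e) (v ∘ e) = diff f x y u v := by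
  classical
  rw [diff, diff]
  congr 1
  · refine f.eval_congr e.optionCongr _ _ _ fun o => ?_
    cases o <;> rfl
  · refine @Fintype.sum_equiv _ _ _ (_) (_) _ e _ _ fun i => ?_
    refine f.eval_congr e _ _ _ fun j => ?_
    simp [Function.update_apply]

theorem diff_update_add (f : Hom k X Y) {ι : Type*} [Finite ι] [DecidableEq ι] (x y : Z ⟶ X)
    (u v : ι → (Z ⟶ X)) (i : ι) (a b a' b' : Z ⟶ X) :
    diff f x y (Function.update u i (a + a')) (Function.update v i (b + b')) =
      diff f x y (Function.update u i a) (Function.update v i b) +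
        diff f x y (Function.update u i a') (Function.update v i b') := by
  let _ := Fintype.ofFinite ι
  have key : ∀ c : Z ⟶ X, (fun o : Option ι => o.elim y (Function.update u i c)) =
      Function.update (fun o : Option ι => o.elim y u) (some i) c := by
    intro c
    funext o
    cases o <;> simp [Function.update_apply]
  simp only [diff_eq, key, Hom.eval_update_add]
  rw [add_add_add_comm, ← Finset.sum_add_distrib]
  congr 1
  refine Finset.sum_congr rfl fun j _ => ?_
  by_cases h : j = i
  · subst h
    simp only [Function.update_self, Function.update_idem]
    exact f.eval_update_add x u j b b' 
  · simp only [Function.update_of_ne h]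
    simp only [Function.update_comm (Ne.symm h)]
    exact f.eval_update_add x (Function.update u j (v j)) i a a'

theorem diff_update_smul (f : Hom k X Y) {ι : Type*} [Finite ι] [DecidableEq ι] (x y : Z ⟶ X)
    (u v : ι → (Z ⟶ X)) (i : ι) (r : k) (a b : Z ⟶ X) :
    diff f x y (Function.update u i (r • a)) (Function.update v i (r • b)) =
      r • diff f x y (Function.update u i a) (Function.update v i b) := by
  let _ := Fintype.ofFinite ι
  have key : ∀ c : Z ⟶ X, (fun o : Option ι => o.elim y (Function.update u i c)) =
      Function.update (fun o : Option ι => o.elim y u) (some i) c := by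
    intro c
    funext o
    cases o <;> simp [Function.update_apply]
  simp only [diff_eq, key, Hom.eval_update_smul]
  rw [smul_add, Finset.smul_sum]
  congr 1
  refine Finset.sum_congr rfl fun j _ => ?_
  by_cases h : j = i
  · subst h
    simp only [Function.update_self, Function.update_idem]
    exact f.eval_update_smul x u j r b
  · simp only [Function.update_of_ne h]
    simp only [Function.update_comm (Ne.symm h)]
    exact f.eval_update_smul x (Function.update u j (v j)) i r a

theorem app_diff (f : Hom k X Y) {n : ℕ} (x : Z ⟶ X ⊗ X) (v : Fin n → (Z ⟶ X ⊗ X)) :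
    app (diff f (fst (X ⊗ X) (power (X ⊗ X) n) ≫ fst X X)
        (fst (X ⊗ X) (power (X ⊗ X) n) ≫ snd X X)
        (fun i => (snd (X ⊗ X) (power (X ⊗ X) n) ≫ proj (X ⊗ X) n i) ≫ fst X X)
        (fun i => (snd (X ⊗ X) (power (X ⊗ X) n) ≫ proj (X ⊗ X) n i) ≫ snd X X)) x v =
      diff f (x ≫ fst X X) (x ≫ snd X X) (fun i => v i ≫ fst X X) fun i => v i ≫ snd X X := by
  rw [app, comp_diff]
  simp

theorem update_comp_right {ι : Type*} [DecidableEq ι] (v : ι → (Z ⟶ X)) (i : ι) (a : Z ⟶ X)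
    (p : X ⟶ Y) : (fun j => Function.update v i a j ≫ p) =
      Function.update (fun j => v j ≫ p) i (a ≫ p) := by
  funext j
  simp only [Function.update_apply]
  split_ifs <;> rfl

/-- The differential of a Faà di Bruno morphism:
`(D f)⁽ⁿ⁾ ((x₀, y₀), …, (xₙ, yₙ)) = f⁽ⁿ⁺¹⁾ (x₀, …, xₙ, y₀) + ∑ i, f⁽ⁿ⁾ (x₀, …, yᵢ, …, xₙ)`, where
`yᵢ` replaces `xᵢ` and `i` runs over `1, …, n`. -/
noncomputable def Hom.D (f : Hom k X Y) : Hom k (X ⊗ X) Y where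
  comp n := diff f (fst (X ⊗ X) (power (X ⊗ X) n) ≫ fst X X)
    (fst (X ⊗ X) (power (X ⊗ X) n) ≫ snd X X)
    (fun i => (snd (X ⊗ X) (power (X ⊗ X) n) ≫ proj (X ⊗ X) n i) ≫ fst X X)
    (fun i => (snd (X ⊗ X) (power (X ⊗ X) n) ≫ proj (X ⊗ X) n i) ≫ snd X X)
  symm x v σ := by
    rw [app_diff, app_diff]
    exact diff_equiv f σ _ _ (fun i => v i ≫ fst X X) fun i => v i ≫ snd X X
  map_add x v i a b := by
    rw [app_diff, app_diff, app_diff]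
    simp only [update_comp_right, CartesianLeftLinear.add_fst k, CartesianLeftLinear.add_snd k,
      diff_update_add]
  map_smul x v i r a := by
    rw [app_diff, app_diff]
    simp only [update_comp_right, CartesianLeftLinear.smul_fst, CartesianLeftLinear.smul_snd,
      diff_update_smul]

theorem Hom.D_eval (f : Hom k X Y) {ι : Type*} [Finite ι] (x : Z ⟶ X ⊗ X)
    (v : ι → (Z ⟶ X ⊗ X)) : f.D.eval x v =
      diff f (x ≫ fst X X) (x ≫ snd X X) (fun i => v i ≫ fst X X) fun i => v i ≫ snd X X := by
  rw [← Hom.eval_equiv _ (Finite.equivFin ι).symm, eval_fin,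
    ← diff_equiv _ (Finite.equivFin ι).symm]
  exact app_diff _ _ _

theorem Hom.D_eval_lift (f : Hom k X Y) {ι : Type*} [Finite ι] (x y : Z ⟶ X)
    (u v : ι → (Z ⟶ X)) : f.D.eval (lift x y) (fun i => lift (u i) (v i)) = diff f x y u v := by
  simp [D_eval]

theorem Hom.eval_option (f : Hom k X Y) {ι : Type*} [Finite ι] (x y : Z ⟶ X) (v : ι → (Z ⟶ X)) :
    f.eval x (fun o : Option ι => o.elim y v) =
      f.D.eval (lift x y) fun i => lift (v i) (0 : Z ⟶ X) := by
  classical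
  rw [D_eval_lift, diff, Finset.sum_eq_zero, add_zero]
  intro i _
  exact f.eval_update_zero _ _ _

theorem Hom.eval_succ (f : Hom k X Y) {n : ℕ} (x : Z ⟶ X) (v : Fin (n + 1) → (Z ⟶ X)) :
    f.eval x v = f.D.eval (lift x (v 0)) fun i : Fin n => lift (v i.succ) (0 : Z ⟶ X) := by
  rw [← eval_option f x (v 0) fun i : Fin n => v i.succ]
  refine f.eval_congr (finSuccEquiv n) _ _ _ fun i => ?_
  induction i using Fin.cases <;> simp

theorem Hom.eval_isEmpty (f : Hom k X Y) {ι : Type*} [Finite ι] [IsEmpty ι] (x : Z ⟶ X)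
    (v : ι → (Z ⟶ X)) : f.eval x v = f.eval x (Fin.elim0 : Fin 0 → (Z ⟶ X)) :=
  f.eval_congr (Equiv.equivOfIsEmpty _ _) _ _ _ fun i => isEmptyElim i

theorem Hom.then_eval_zero (f : Hom k X Y) (g : Hom k Y T) (x : Z ⟶ X)
    (v : Fin 0 → (Z ⟶ X)) : (f.then g).eval x v =
      g.eval (f.eval x (Fin.elim0 : Fin 0 → (Z ⟶ X))) (Fin.elim0 : Fin 0 → (Z ⟶ Y)) := by
  rw [then_eval, chain]
  have : Unique (Setoid (Fin 0)) :=
    { default := ⊥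
      uniq := fun s => by ext a; exact a.elim0 }
  rw [Fintype.sum_unique]
  exact eval_isEmpty _ _ _

/-- Precomposition of all the components of `f` with a `k`-linear map. -/
def Hom.pre (p : X ⟶ Y) (hp : IsLinear k p) (f : Hom k Y T) : Hom k X T where
  comp n := app (f.comp n) (fst X (power X n) ≫ p) fun i =>
    (snd X (power X n) ≫ proj X n i) ≫ p
  symm {n _} x v σ := by
    have := f.symm (x ≫ p) (fun i => v i ≫ p) σ
    simpa [app, comp_tuple, ← Category.assoc, comp_lift, Function.comp_def] using this
  map_add {n _} x v i a b := by
    have := f.map_add (x ≫ p) (fun i => v i ≫ p) i (a ≫ p) (b ≫ p)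
    rw [← hp.add, ← update_comp_right, ← update_comp_right, ← update_comp_right] at this
    simpa [app, comp_tuple, ← Category.assoc, comp_lift] using this
  map_smul {n _} x v i r a := by
    have := f.map_smul (x ≫ p) (fun i => v i ≫ p) i r (a ≫ p)
    rw [← hp.smul, ← update_comp_right, ← update_comp_right] at this
    simpa [app, comp_tuple, ← Category.assoc, comp_lift] using this

theorem Hom.pre_eval (p : X ⟶ Y) (hp : IsLinear k p) (f : Hom k Y T) {ι : Type*} [Finite ι]
    (x : Z ⟶ X) (v : ι → (Z ⟶ X)) : (f.pre p hp).eval x v = f.eval (x ≫ p) fun i => v i ≫ p := by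
  simp [eval, pre, app, comp_tuple, ← Category.assoc, comp_lift, Function.comp_def]

/-! ### Partitions of a set with one more element -/

/-- The labelling of `Option ι` by the blocks of `s` and one new block for the new element. -/
def labelNone {ι : Type*} (s : Setoid ι) (o : Option ι) : Option (Quotient s) :=
  o.elim none fun i => some (Quotient.mk s i)

/-- The labelling of `Option ι` by the blocks of `s`, with label `q` for the new element. -/
def labelSome {ι : Type*} (s : Setoid ι) (q : Quotient s) (o : Option ι) : Quotient s :=
  o.elim q (Quotient.mk s)

/-- The partitions of `Option ι` which restrict to `s`: the new element either forms a block of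
its own, or is adjoined to a block of `s`. -/
def extend {ι : Type*} (s : Setoid ι) : Option (Quotient s) → Setoid (Option ι)
  | none => Setoid.ker (labelNone s)
  | some q => Setoid.ker (labelSome s q)

theorem extend_none {ι : Type*} (s : Setoid ι) : extend s none = Setoid.ker (labelNone s) := rfl

theorem extend_some {ι : Type*} (s : Setoid ι) (q : Quotient s) :
    extend s (some q) = Setoid.ker (labelSome s q) := rfl

theorem extend_some_some {ι : Type*} (s : Setoid ι) (q : Option (Quotient s)) (a b : ι) :
    extend s q (some a) (some b) ↔ s a b := by
  match q with
  | none => exact Option.some_inj.trans Quotient.eq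
  | some q => exact Quotient.eq

theorem extend_none_some {ι : Type*} (s : Setoid ι) (q : Option (Quotient s)) (a : ι) :
    extend s q none (some a) ↔ q = some (Quotient.mk s a) := by
  match q with
  | none => exact Iff.rfl
  | some q => exact Option.some_inj.symm

theorem extend_bijective (ι : Type*) : Function.Bijective
    fun p : (Σ s : Setoid ι, Option (Quotient s)) => extend p.1 p.2 := by
  constructor
  · rintro ⟨s, q⟩ ⟨t, r⟩ h
    dsimp only at h
    obtain rfl : s = t := by
      ext a b
      rw [← extend_some_some s q, h, extend_some_some]
    have : ∀ a, q = some (Quotient.mk s a) ↔ r = some (Quotient.mk s a) := fun a => by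
      rw [← extend_none_some, ← extend_none_some, h]
    congr 1
    ext c
    induction c using Quotient.inductionOn with
    | h a => simpa using this a
  · intro S
    classical
    let s := S.comap some
    by_cases h : ∃ a, S none (some a)
    · obtain ⟨a, ha⟩ := h
      refine ⟨⟨s, some (Quotient.mk s a)⟩, ?_⟩
      have key : ∀ b, extend s (some (Quotient.mk s a)) none (some b) ↔ S none (some b) := by
        intro b
        rw [extend_none_some, Option.some_inj, Quotient.eq]
        exact ⟨fun hb => S.trans ha hb, fun hb => S.trans (S.symm ha) hb⟩
      ext o o'
      cases o <;> cases o'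
      · exact ⟨fun _ => S.refl _, fun _ => Setoid.refl' _ _⟩
      · exact key _
      · rw [Setoid.comm', key, Setoid.comm']
      · exact extend_some_some _ _ _ _
    · refine ⟨⟨s, none⟩, ?_⟩
      have key : ∀ b, extend s none none (some b) ↔ S none (some b) := by
        intro b
        rw [extend_none_some]
        exact ⟨fun hb => (Option.some_ne_none _ hb.symm).elim, fun hb => (h ⟨b, hb⟩).elim⟩
      ext o o'
      cases o <;> cases o'
      · exact ⟨fun _ => S.refl _, fun _ => Setoid.refl' _ _⟩
      · exact key _
      · rw [Setoid.comm', key, Setoid.comm']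
      · exact extend_some_some _ _ _ _

theorem eval_ker (f : Hom k X Y) (g : Hom k Y T) {ι κ : Type*} [Finite ι] [Finite κ] (p : ι → κ)
    (hp : Function.Surjective p) (x : Z ⟶ X) (y : Z ⟶ Y) (v : ι → (Z ⟶ X)) :
    (g.eval y fun q : Quotient (Setoid.ker p) => f.eval x fun i : Block (Setoid.ker p) q => v i) =
      g.eval y fun b : κ => f.eval x fun i : {i // p i = b} => v i := by
  let e : Quotient (Setoid.ker p) ≃ κ := Setoid.quotientKerEquivOfSurjective p hp
  refine g.eval_congr e _ _ _ fun q => ?_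
  let e' : Block (Setoid.ker p) q ≃ {i // p i = e q} :=
    (Equiv.refl ι).subtypeEquiv fun a => by
      change _ ↔ e (Quotient.mk _ a) = e q
      simp
  exact f.eval_congr e' _ _ _ fun i => rfl

/-- The sum over the partitions of `Option ι` in terms of the partitions of `ι`. -/
theorem chain_option (f : Hom k X Y) (g : Hom k Y T) {ι : Type*} [Finite ι]
    [∀ s : Setoid ι, Fintype (Quotient s)] [∀ s : Setoid ι, DecidableEq (Quotient s)]
    (x y : Z ⟶ X) (v : ι → (Z ⟶ X)) :
    chain f g x (fun o : Option ι => o.elim y v) =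
      ∑ s : Setoid ι,
        ((g.eval (f.eval x (Fin.elim0 : Fin 0 → (Z ⟶ X))) fun o : Option (Quotient s) =>
            o.elim (f.eval x fun _ : Fin 1 => y) fun q => f.eval x fun i : Block s q => v i) +
          ∑ q : Quotient s, g.eval (f.eval x (Fin.elim0 : Fin 0 → (Z ⟶ X)))
            (Function.update (fun q => f.eval x fun i : Block s q => v i) q
              (f.eval x fun o : Option (Block s q) => o.elim y fun i => v i))) := by
  rw [chain, ← (extend_bijective ι).sum_comp, Fintype.sum_sigma]
  refine Finset.sum_congr rfl fun s _ => ?_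
  rw [Fintype.sum_option]
  congr 1
  · dsimp only
    rw [extend_none]
    refine (eval_ker f g (labelNone s) ?_ x _ fun o => Option.elim o y v).trans ?_
    · rintro (_ | q)
      · exact ⟨none, rfl⟩
      · induction q using Quotient.inductionOn with
        | h a => exact ⟨some a, rfl⟩
    · congr 1
      funext o
      cases o with
      | none =>
        let e : {o : Option ι // labelNone s o = none} ≃ Fin 1 :=
          { toFun := fun _ => 0
            invFun := fun _ => ⟨none, rfl⟩
            left_inv := by
              rintro ⟨_ | i, hi⟩
              · rfl
              · exact (Option.some_ne_none _ hi).elim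
            right_inv := fun i => Subsingleton.elim _ _ }
        refine f.eval_congr e _ _ _ ?_
        rintro ⟨_ | i, hi⟩
        · rfl
        · exact (Option.some_ne_none _ hi).elim
      | some q =>
        let e : Block s q ≃ {o : Option ι // labelNone s o = some q} :=
          { toFun := fun i => ⟨some i, congrArg some i.2⟩
            invFun := fun o => match o with
              | ⟨none, h⟩ => (Option.some_ne_none _ h.symm).elim
              | ⟨some i, h⟩ => ⟨i, Option.some_injective _ h⟩
            left_inv := fun i => rfl
            right_inv := by
              rintro ⟨_ | i, hi⟩
              · exact (Option.some_ne_none _ hi.symm).elim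
              · rfl }
        exact (f.eval_congr e _ _ _ fun i => rfl).symm
  · refine Finset.sum_congr rfl fun q _ => ?_
    dsimp only
    rw [extend_some]
    refine (eval_ker f g (labelSome s q) ?_ x _ fun o => Option.elim o y v).trans ?_
    · intro q
      induction q using Quotient.inductionOn with
      | h a => exact ⟨some a, rfl⟩
    · congr 1
      funext q'
      by_cases h : q' = q
      · subst h
        rw [Function.update_self]
        let e : {o : Option ι // labelSome s q' o = q'} ≃ Option (Block s q') :=
          { toFun := fun o => match o with
              | ⟨none, _⟩ => none
              | ⟨some i, h⟩ => some ⟨i, h⟩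
            invFun := fun o => match o with
              | none => ⟨none, rfl⟩
              | some i => ⟨some i, i.2⟩
            left_inv := by rintro ⟨_ | i, hi⟩ <;> rfl
            right_inv := by rintro (_ | i) <;> rfl }
        refine f.eval_congr e _ _ _ ?_
        rintro ⟨_ | i, hi⟩ <;> rfl
      · rw [Function.update_of_ne h]
        let e : Block s q' ≃ {o : Option ι // labelSome s q o = q'} :=
          { toFun := fun i => ⟨some i, i.2⟩
            invFun := fun o => match o with
              | ⟨none, h'⟩ => (h h'.symm).elim
              | ⟨some i, h⟩ => ⟨i, h⟩
            left_inv := fun i => rfl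
            right_inv := by
              rintro ⟨_ | i, hi⟩
              · exact (h hi.symm).elim
              · rfl }
        exact (f.eval_congr e _ _ _ fun i => rfl).symm

/-! ### The chain rule, and the laws of a category -/

/-- The pair of `f π₀` and `D f`. -/
noncomputable def Hom.tangent (f : Hom k X Y) : Hom k (X ⊗ X) (Y ⊗ Y) :=
  (f.pre (fst X X) (isLinear_fst k X X)).pair f.D

theorem Hom.D_then (f : Hom k X Y) (g : Hom k Y T) : (f.then g).D = f.tangent.then g.D := by
  refine ext_fin fun n Z w m => ?_
  classical
  let _ : ∀ s : Setoid (Fin n), Fintype (Quotient s) := fun s => Fintype.ofFinite _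
  rw [D_eval, then_eval, diff_eq]
  simp only [then_eval, chain_option]
  simp only [chain]
  simp only [chain_update, tangent, pair_eval, pre_eval, D_eval, lift_fst, lift_snd]
  rw [Finset.sum_comm, ← Finset.sum_add_distrib]
  refine Finset.sum_congr rfl fun s _ => ?_
  rw [diff_eq]
  have h0 (p : X ⊗ X ⟶ X) : (fun i : Fin 0 => (Fin.elim0 i : Z ⟶ X ⊗ X) ≫ p) = Fin.elim0 :=
    Subsingleton.elim _ _
  have h1 : diff f (w ≫ fst X X) (w ≫ snd X X)
      (Fin.elim0 : Fin 0 → (Z ⟶ X)) (Fin.elim0 : Fin 0 → (Z ⟶ X)) =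
      f.eval (w ≫ fst X X) fun _ : Fin 1 => w ≫ snd X X := by
    rw [diff_eq, Finset.univ_eq_empty, Finset.sum_empty, add_zero]
    refine f.eval_congr (finSuccEquiv 0).symm _ _ _ ?_
    rintro (_ | i)
    · rfl
    · exact i.elim0
  rw [h0, h0, h1, add_assoc]
  congr 1
  let _ : ∀ q : Quotient s, Fintype (Block s q) := fun q => Fintype.ofFinite _
  simp only [diff_eq, eval_update_add, Finset.sum_add_distrib, eval_update_sum]
  congr 1
  rw [← Fintype.sum_sigma', ← (Equiv.sigmaFiberEquiv (Quotient.mk s)).sum_comp]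
  refine Finset.sum_congr rfl ?_
  rintro ⟨q, i, rfl⟩ _
  rfl

theorem Hom.tangent_eval (f : Hom k X Y) {ι : Type*} [Finite ι] (x : Z ⟶ X ⊗ X)
    (v : ι → (Z ⟶ X ⊗ X)) : f.tangent.eval x v =
      lift (f.eval (x ≫ fst X X) fun i => v i ≫ fst X X) (f.D.eval x v) := by
  rw [tangent, pair_eval, pre_eval]

theorem Hom.then_pair (f : Hom k X Y) (g : Hom k Y T) (h : Hom k Y W) :
    f.then (g.pair h) = (f.then g).pair (f.then h) := by
  refine ext_fin fun n Z x v => ?_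
  simp only [pair_eval, then_eval, chain]
  refine CartesianMonoidalCategory.hom_ext _ _ ?_ ?_
  · rw [(isLinear_fst k _ _).sum, lift_fst]
    simp
  · rw [(isLinear_snd k _ _).sum, lift_snd]
    simp

theorem Hom.tangent_then_pre (f : Hom k X Y) (g : Hom k Y T) :
    f.tangent.then (g.pre (fst Y Y) (isLinear_fst k Y Y)) =
      (f.then g).pre (fst X X) (isLinear_fst k X X) := by
  refine ext_fin fun n Z x v => ?_
  simp only [pre_eval, then_eval, chain, tangent_eval, lift_fst]
  have h0 (p : X ⊗ X ⟶ X) : (fun i : Fin 0 => (Fin.elim0 i : Z ⟶ X ⊗ X) ≫ p) = Fin.elim0 :=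
    Subsingleton.elim _ _
  simp only [h0]

theorem Hom.tangent_then (f : Hom k X Y) (g : Hom k Y T) :
    (f.then g).tangent = f.tangent.then g.tangent := by
  rw [tangent, tangent.eq_1 g, then_pair, D_then, tangent_then_pre]

theorem Hom.then_assoc_eval (n : ℕ) : ∀ {X Y T V Z : C} (f : Hom k X Y) (g : Hom k Y T)
    (h : Hom k T V) (x : Z ⟶ X) (v : Fin n → (Z ⟶ X)),
    ((f.then g).then h).eval x v = (f.then (g.then h)).eval x v := by
  induction n with
  | zero =>
    intros
    simp only [then_eval_zero]
  | succ n ih =>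
    intro X Y T V Z f g h x v
    rw [eval_succ, eval_succ]
    simp only [D_then, tangent_then, ih]

theorem Hom.then_assoc (f : Hom k X Y) (g : Hom k Y T) (h : Hom k T V) :
    (f.then g).then h = f.then (g.then h) :=
  ext_fin fun n _ x v => then_assoc_eval n f g h x v

theorem Hom.lin_eval_zero (p : X ⟶ Y) (hp : IsLinear k p) (x : Z ⟶ X) (v : Fin 0 → (Z ⟶ X)) :
    (Hom.lin p hp).eval x v = x ≫ p := by
  rw [eval_fin]
  exact app_linComp_zero _ _ _

theorem Hom.lin_eval_one (p : X ⟶ Y) (hp : IsLinear k p) (x : Z ⟶ X) (v : Fin 1 → (Z ⟶ X)) :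
    (Hom.lin p hp).eval x v = v 0 ≫ p := by
  rw [eval_fin]
  exact app_linComp_one _ _ _

theorem Hom.lin_eval_add_two (p : X ⟶ Y) (hp : IsLinear k p) {n : ℕ} (x : Z ⟶ X)
    (v : Fin (n + 2) → (Z ⟶ X)) : (Hom.lin p hp).eval x v = 0 := by
  rw [eval_fin]
  exact app_linComp_add_two p x v

theorem Hom.D_lin (p : X ⟶ Y) (hp : IsLinear k p) :
    (Hom.lin p hp).D = Hom.lin (snd X X ≫ p) ((isLinear_snd k X X).comp hp) := by
  refine ext_fin fun n Z x v => ?_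
  rw [D_eval, diff_eq]
  have h : ∀ (y : Z ⟶ X) (u : Fin n → (Z ⟶ X)),
      (Hom.lin p hp).eval (x ≫ fst X X) (fun o : Option (Fin n) => o.elim y u) =
        (Hom.lin p hp).eval (x ≫ fst X X) (Fin.cons y u : Fin (n + 1) → (Z ⟶ X)) := by
    intro y u
    refine eval_congr _ (finSuccEquiv n).symm _ _ _ ?_
    rintro (_ | i) <;> simp
  rw [h]
  match n with
  | 0 => rw [lin_eval_one, lin_eval_zero]; simp
  | 1 => rw [lin_eval_add_two, lin_eval_one]; simp [lin_eval_one, -eval_fin]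
  | n + 2 => rw [lin_eval_add_two, lin_eval_add_two]; simp [lin_eval_add_two, -eval_fin]

theorem Hom.then_lin_eval (n : ℕ) : ∀ {X Y T Z : C} (f : Hom k X Y) (p : Y ⟶ T)
    (hp : IsLinear k p) (x : Z ⟶ X) (v : Fin n → (Z ⟶ X)),
    (f.then (Hom.lin p hp)).eval x v = f.eval x v ≫ p := by
  induction n with
  | zero =>
    intro X Y T Z f p hp x v
    rw [then_eval_zero, lin_eval_zero, eval_isEmpty f x v]
  | succ n ih =>
    intro X Y T Z f p hp x v
    rw [eval_succ, eval_succ, D_then, D_lin, ih, tangent_eval, lift_snd_assoc]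

theorem Hom.then_lin (f : Hom k X Y) (p : Y ⟶ T) (hp : IsLinear k p) :
    f.then (Hom.lin p hp) = f.post p hp :=
  ext_fin fun n _ x v => by rw [then_lin_eval, post_eval]

theorem Hom.post_lin (p : X ⟶ Y) (hp : IsLinear k p) (q : Y ⟶ T) (hq : IsLinear k q) :
    (Hom.lin p hp).post q hq = Hom.lin (p ≫ q) (hp.comp hq) := by
  refine ext_fin fun n Z x v => ?_
  rw [post_eval]
  match n with
  | 0 => rw [lin_eval_zero, lin_eval_zero, Category.assoc]
  | 1 => rw [lin_eval_one, lin_eval_one, Category.assoc]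
  | n + 2 => rw [lin_eval_add_two, lin_eval_add_two, hq.zero]

theorem Hom.pre_lin (p : X ⟶ Y) (hp : IsLinear k p) (q : Y ⟶ T) (hq : IsLinear k q) :
    (Hom.lin q hq).pre p hp = Hom.lin (p ≫ q) (hp.comp hq) := by
  refine ext_fin fun n Z x v => ?_
  rw [pre_eval]
  match n with
  | 0 => rw [lin_eval_zero, lin_eval_zero, Category.assoc]
  | 1 => rw [lin_eval_one, lin_eval_one, Category.assoc]
  | n + 2 => rw [lin_eval_add_two, lin_eval_add_two]

theorem Hom.pair_ext {f g : Hom k X (Y ⊗ T)}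
    (h₁ : f.post (fst Y T) (isLinear_fst k Y T) = g.post (fst Y T) (isLinear_fst k Y T))
    (h₂ : f.post (snd Y T) (isLinear_snd k Y T) = g.post (snd Y T) (isLinear_snd k Y T)) :
    f = g := by
  ext n
  · exact congrFun (congrArg Hom.comp h₁) n
  · exact congrFun (congrArg Hom.comp h₂) n

theorem Hom.pair_post_fst (f : Hom k X Y) (g : Hom k X T) :
    (f.pair g).post (fst Y T) (isLinear_fst k Y T) = f :=
  Hom.ext (funext fun _ => lift_fst _ _)

theorem Hom.pair_post_snd (f : Hom k X Y) (g : Hom k X T) :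
    (f.pair g).post (snd Y T) (isLinear_snd k Y T) = g :=
  Hom.ext (funext fun _ => lift_snd _ _)

theorem IsLinear.map {p : X ⟶ Y} (hp : IsLinear k p) :
    IsLinear k (lift (fst X X ≫ p) (snd X X ≫ p)) where
  add a b := by
    simp only [comp_lift, ← Category.assoc, CartesianLeftLinear.add_fst k,
      CartesianLeftLinear.add_snd k, hp.add, lift_add k]
  smul r a := by
    simp only [comp_lift, ← Category.assoc, CartesianLeftLinear.smul_fst,
      CartesianLeftLinear.smul_snd, hp.smul, lift_smul]

theorem Hom.tangent_lin (p : X ⟶ Y) (hp : IsLinear k p) :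
    (Hom.lin p hp).tangent = Hom.lin (lift (fst X X ≫ p) (snd X X ≫ p)) hp.map := by
  rw [tangent, D_lin, pre_lin]
  refine pair_ext ?_ ?_
  · rw [pair_post_fst, post_lin]
    congr 1
    simp
  · rw [pair_post_snd, post_lin]
    congr 1
    simp

theorem Hom.lin_then_eval (n : ℕ) : ∀ {X Y T Z : C} (p : X ⟶ Y) (hp : IsLinear k p)
    (f : Hom k Y T) (x : Z ⟶ X) (v : Fin n → (Z ⟶ X)),
    ((Hom.lin p hp).then f).eval x v = f.eval (x ≫ p) fun i => v i ≫ p := by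
  induction n with
  | zero =>
    intro X Y T Z p hp f x v
    rw [then_eval_zero, lin_eval_zero, eval_isEmpty f (x ≫ p) fun i => v i ≫ p]
  | succ n ih =>
    intro X Y T Z p hp f x v
    rw [eval_succ, eval_succ, D_then, tangent_lin, ih]
    congr 1
    · simp
    · funext i
      simp [hp.zero]

theorem Hom.lin_then (p : X ⟶ Y) (hp : IsLinear k p) (f : Hom k Y T) :
    (Hom.lin p hp).then f = f.pre p hp :=
  ext_fin fun n _ x v => by rw [lin_then_eval, pre_eval]

theorem Hom.id_then (f : Hom k X Y) : (Hom.id X).then f = f := by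
  rw [Hom.id, lin_then]
  exact ext_fin fun n _ x v => by rw [pre_eval]; simp

theorem Hom.then_id (f : Hom k X Y) : f.then (Hom.id Y) = f := by
  rw [Hom.id, then_lin]
  exact Hom.ext (funext fun _ => Category.comp_id _)

theorem Hom.then_add (f : Hom k X Y) (g h : Hom k Y T) :
    f.then (g + h) = f.then g + f.then h :=
  ext_fin fun n _ x v => by
    simp only [then_eval, add_eval, chain, Finset.sum_add_distrib]

theorem Hom.then_smul (f : Hom k X Y) (r : k) (g : Hom k Y T) :
    f.then (r • g) = r • f.then g :=
  ext_fin fun n _ x v => by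
    simp only [then_eval, smul_eval, chain, Finset.smul_sum]

theorem Hom.then_zero (f : Hom k X Y) : f.then (0 : Hom k Y T) = 0 := by
  simpa using f.then_smul 0 (0 : Hom k Y T)

/-! ### The laws of the differential -/

theorem Hom.D_add (f g : Hom k X Y) : (f + g).D = f.D + g.D :=
  ext_fin fun n _ x v => by
    simp only [D_eval, add_eval, diff_eq, Finset.sum_add_distrib]
    exact add_add_add_comm _ _ _ _

theorem Hom.D_smul (r : k) (f : Hom k X Y) : (r • f).D = r • f.D :=
  ext_fin fun n _ x v => by
    simp only [D_eval, smul_eval, diff_eq, Finset.smul_sum, smul_add]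

theorem diff_add (f : Hom k X Y) {ι : Type*} [Finite ι] (x y y' : Z ⟶ X) (u v v' : ι → (Z ⟶ X)) :
    diff f x (y + y') u (fun i => v i + v' i) = diff f x y u v + diff f x y' u v' := by
  classical
  let _ := Fintype.ofFinite ι
  have h (c : Z ⟶ X) : (fun o : Option ι => o.elim c u) =
      Function.update (fun o : Option ι => o.elim 0 u) none c := by
    funext o
    cases o <;> simp
  rw [diff_eq, diff_eq, diff_eq, h (y + y'), h y, h y', Hom.eval_update_add]
  simp only [Hom.eval_update_add, Finset.sum_add_distrib]
  exact add_add_add_comm _ _ _ _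

theorem diff_smul (f : Hom k X Y) {ι : Type*} [Finite ι] (r : k) (x y : Z ⟶ X)
    (u v : ι → (Z ⟶ X)) : diff f x (r • y) u (fun i => r • v i) = r • diff f x y u v := by
  classical
  let _ := Fintype.ofFinite ι
  have h (c : Z ⟶ X) : (fun o : Option ι => o.elim c u) =
      Function.update (fun o : Option ι => o.elim 0 u) none c := by
    funext o
    cases o <;> simp
  rw [diff_eq, diff_eq, h (r • y), h y, Hom.eval_update_smul]
  simp only [Hom.eval_update_smul, Finset.smul_sum, smul_add]

/-- `D f` composed with a pairing. -/
theorem Hom.pair_then_D_eval (x v : Hom k W X) (f : Hom k X Y) {ι : Type*} [Finite ι]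
    (z : Z ⟶ W) (m : ι → (Z ⟶ W)) : ((x.pair v).then f.D).eval z m =
      ∑ s : Setoid ι, diff f (x.eval z (Fin.elim0 : Fin 0 → (Z ⟶ W)))
        (v.eval z (Fin.elim0 : Fin 0 → (Z ⟶ W)))
        (fun q : Quotient s => x.eval z fun i : Block s q => m i)
        fun q : Quotient s => v.eval z fun i : Block s q => m i := by
  rw [then_eval, chain]
  simp only [pair_eval, D_eval_lift]

theorem Hom.pair_add_then_D (f : Hom k X Y) (x v v' : Hom k W X) :
    (x.pair (v + v')).then f.D = (x.pair v).then f.D + (x.pair v').then f.D :=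
  ext_fin fun n _ z m => by
    simp only [pair_then_D_eval, add_eval, diff_add, Finset.sum_add_distrib]

theorem Hom.pair_smul_then_D (f : Hom k X Y) (r : k) (x v : Hom k W X) :
    (x.pair (r • v)).then f.D = r • (x.pair v).then f.D :=
  ext_fin fun n _ z m => by
    simp only [pair_then_D_eval, smul_eval, diff_smul, Finset.smul_sum]

theorem diff_option (f : Hom k X Y) {ι : Type*} [Fintype ι] [DecidableEq ι]
    (x y y' : Z ⟶ X) (r : Z ⟶ X) (u v : ι → (Z ⟶ X)) :
    diff f x y (fun o : Option ι => o.elim r u) (fun o : Option ι => o.elim y' v) =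
      f.eval x (fun o : Option (Option ι) => o.elim y fun o' => o'.elim r u) +
        (f.eval x (fun o : Option ι => o.elim y' u) +
          ∑ i, f.eval x fun o : Option ι => o.elim r (Function.update u i (v i))) := by
  rw [diff_eq, Fintype.sum_option]
  congr 3
  · funext o
    cases o <;> simp
  · funext i
    congr 1
    funext o
    cases o <;> simp [Function.update_apply]

theorem diff_D (f : Hom k X Y) {ι : Type*} [Fintype ι] [DecidableEq ι]
    (x r s w : Z ⟶ X) (xs rs ss ws : ι → (Z ⟶ X)) :
    diff f.D (lift x r) (lift s w) (fun i => lift (xs i) (rs i)) (fun i => lift (ss i) (ws i)) =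
      f.eval x (fun o : Option (Option ι) => o.elim r fun o' => o'.elim s xs) +
        (f.eval x (fun o : Option ι => o.elim w xs) +
          ∑ i, f.eval x fun o : Option ι => o.elim s (Function.update xs i (rs i))) +
      ∑ i, (f.eval x (fun o : Option ι => o.elim r (Function.update xs i (ss i))) +
        ∑ j, f.eval x (Function.update (Function.update xs i (ss i)) j
          (Function.update rs i (ws i) j))) := by
  rw [diff_eq]
  have h1 : (fun o : Option ι => o.elim (lift s w) fun i => lift (xs i) (rs i)) =
      fun o : Option ι => lift (o.elim s xs) (o.elim w rs) := by
    funext o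
    cases o <;> rfl
  have h2 (i : ι) : Function.update (fun i => lift (xs i) (rs i)) i (lift (ss i) (ws i)) =
      fun j => lift (Function.update xs i (ss i) j) (Function.update rs i (ws i) j) := by
    funext j
    simp only [Function.update_apply]
    split_ifs <;> rfl
  rw [h1, Hom.D_eval_lift, diff_option]
  simp only [h2, Hom.D_eval_lift, diff_eq]

theorem diff_D_linear (f : Hom k X Y) {ι : Type*} [Finite ι]
    (x r w : Z ⟶ X) (xs rs ws : ι → (Z ⟶ X)) :
    diff f.D (lift x r) (lift 0 w) (fun i => lift (xs i) (rs i)) (fun i => lift 0 (ws i)) =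
      diff f x w xs ws := by
  classical
  let _ := Fintype.ofFinite ι
  rw [diff_D, diff_eq, f.eval_eq_zero _ _ (some none) rfl, zero_add]
  congr 1
  · rw [Finset.sum_eq_zero, add_zero]
    exact fun i _ => f.eval_eq_zero _ _ none rfl
  · refine Finset.sum_congr rfl fun i _ => ?_
    rw [f.eval_eq_zero x (fun o : Option ι => o.elim r (Function.update xs i 0)) (some i)
      (by simp), zero_add,
      Finset.sum_eq_single i]
    · simp
    · intro j _ hj
      refine f.eval_eq_zero _ _ i ?_
      rw [Function.update_of_ne (Ne.symm hj), Function.update_self]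
    · simp

theorem diff_D_symm (f : Hom k X Y) {ι : Type*} [Finite ι]
    (x r s : Z ⟶ X) (xs rs ss : ι → (Z ⟶ X)) :
    diff f.D (lift x r) (lift s 0) (fun i => lift (xs i) (rs i)) (fun i => lift (ss i) 0) =
      diff f.D (lift x s) (lift r 0) (fun i => lift (xs i) (ss i)) (fun i => lift (rs i) 0) := by
  classical
  let _ := Fintype.ofFinite ι
  rw [diff_D, diff_D, f.eval_eq_zero (ι := Option ι) x _ none rfl, zero_add,
    Finset.sum_add_distrib, Finset.sum_add_distrib, add_assoc, add_assoc, add_left_comm (a := ∑ i, _)]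
  rw [zero_add]
  congr 1
  · let e : Option (Option ι) ≃ Option (Option ι) := Equiv.swap none (some none)
    refine f.eval_congr e _ _ _ ?_
    rintro (_ | _ | i)
    · simp [e]
    · simp [e]
    · rw [Equiv.swap_apply_of_ne_of_ne (by simp) (by simp)]
      rfl
  · congr 2
    rw [Finset.sum_comm]
    refine Finset.sum_congr rfl fun i _ => Finset.sum_congr rfl fun j _ => ?_
    by_cases h : i = j
    · subst h
      rw [f.eval_eq_zero _ _ i (by simp), f.eval_eq_zero _ _ i (by simp)]
    · rw [Function.update_of_ne h, Function.update_of_ne (Ne.symm h), Function.update_comm h]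

theorem Hom.D_D_linear (f : Hom k X Y) (x r v : Hom k W X) :
    ((x.pair r).pair ((0 : Hom k W X).pair v)).then f.D.D = (x.pair v).then f.D :=
  ext_fin fun n _ z m => by
    simp only [pair_then_D_eval, pair_eval, zero_eval, diff_D_linear]

theorem Hom.D_D_symm (f : Hom k X Y) (x r s : Hom k W X) :
    ((x.pair r).pair (s.pair 0)).then f.D.D = ((x.pair s).pair (r.pair 0)).then f.D.D :=
  ext_fin fun n _ z m => by
    simp only [pair_then_D_eval, pair_eval, zero_eval]
    exact Finset.sum_congr rfl fun _ _ => diff_D_symm _ _ _ _ _ _ _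

end Cartesian

end FaaDiBruno

/-! ### The Faà di Bruno category -/

/-- The Faà di Bruno category of `C`. Its objects are those of `C` (the structure is a wrapper,
which keeps its morphisms apart from those of `C`). -/
@[ext, nolint unusedArguments]
structure Faa (k : Type w) [CommSemiring k] (C : Type u) : Type u where
  /-- The underlying object of `C`. -/
  obj : C

namespace Faa

open FaaDiBruno Limits

variable (k : Type w) [CommSemiring k] (C : Type u) [Category.{v} C]
  [CartesianMonoidalCategory C] [LeftAdditive C] [LeftLinear k C] [CartesianLeftLinear k C]

/-- Identities and composition of the Faà di Bruno category. -/
noncomputable instance instCategory : Category.{v} (Faa k C) where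
  Hom X Y := FaaDiBruno.Hom k X.obj Y.obj
  id X := Hom.id X.obj
  comp f g := Hom.then f g
  id_comp f := Hom.id_then f
  comp_id f := Hom.then_id f
  assoc f g h := Hom.then_assoc f g h

/-- Addition of morphisms is componentwise. -/
noncomputable instance instLeftAdditive : LeftAdditive (Faa k C) where
  homAddCommMonoid X Y := inferInstanceAs (AddCommMonoid (FaaDiBruno.Hom k X.obj Y.obj))
  comp_add f g h := Hom.then_add f g h
  comp_zero f _ := Hom.then_zero f

/-- Scalar multiplication of morphisms is componentwise. -/
noncomputable instance instLeftLinear : LeftLinear k (Faa k C) where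
  homModule X Y := inferInstanceAs (Module k (FaaDiBruno.Hom k X.obj Y.obj))
  comp_smul f r g := Hom.then_smul f r g

/-- The terminal object is that of `C`. -/
noncomputable def terminalCone : LimitCone (Functor.empty.{0} (Faa k C)) where
  cone := asEmptyCone ⟨𝟙_ C⟩
  isLimit := IsTerminal.ofUniqueHom (fun X => (0 : FaaDiBruno.Hom k X.obj (𝟙_ C)))
    fun _ _ => Hom.ext (funext fun _ => toUnit_unique _ _)

/-- The product of `X` and `Y` is their product in `C`, with the projections
`πᵢ⁽⁰⁾ = πᵢ`, `πᵢ⁽¹⁾ = πᵢ π₁`, `πᵢ⁽ⁿ⁾ = 0` for `n ≥ 2`. -/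
noncomputable def productCone (X Y : Faa k C) : LimitCone (pair X Y) where
  cone := BinaryFan.mk (P := (⟨X.obj ⊗ Y.obj⟩ : Faa k C))
    (Hom.lin (fst X.obj Y.obj) (isLinear_fst k X.obj Y.obj))
    (Hom.lin (snd X.obj Y.obj) (isLinear_snd k X.obj Y.obj))
  isLimit := BinaryFan.IsLimit.mk _ (fun f g => Hom.pair f g)
    (fun f g => (Hom.then_lin _ _ _).trans (Hom.pair_post_fst f g))
    (fun f g => (Hom.then_lin _ _ _).trans (Hom.pair_post_snd f g))
    fun f g _ h₁ h₂ => Hom.pair_ext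
      (((Hom.then_lin _ _ _).symm.trans h₁).trans (Hom.pair_post_fst f g).symm)
      (((Hom.then_lin _ _ _).symm.trans h₂).trans (Hom.pair_post_snd f g).symm)

/-- The chosen finite products of the Faà di Bruno category. -/
noncomputable instance instCartesian : CartesianMonoidalCategory (Faa k C) :=
  CartesianMonoidalCategory.ofChosenFiniteProducts (terminalCone k C) (productCone k C)

variable {k C}

theorem lift_eq {X Y Z : Faa k C} (f : X ⟶ Y) (g : X ⟶ Z) : lift f g = Hom.pair f g :=
  CartesianMonoidalCategory.hom_ext _ _
    ((lift_fst f g).trans ((Hom.then_lin _ _ _).trans (Hom.pair_post_fst f g)).symm)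
    ((lift_snd f g).trans ((Hom.then_lin _ _ _).trans (Hom.pair_post_snd f g)).symm)

theorem comp_fst_eq {X Y Z : Faa k C} (f : Z ⟶ X ⊗ Y) :
    f ≫ fst X Y = Hom.post f (fst X.obj Y.obj) (isLinear_fst k X.obj Y.obj) :=
  Hom.then_lin _ _ _

theorem comp_snd_eq {X Y Z : Faa k C} (f : Z ⟶ X ⊗ Y) :
    f ≫ snd X Y = Hom.post f (snd X.obj Y.obj) (isLinear_snd k X.obj Y.obj) :=
  Hom.then_lin _ _ _

variable (k C)

instance instCartesianLeftLinear : CartesianLeftLinear k (Faa k C) where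
  add_fst f g := by
    rw [comp_fst_eq, comp_fst_eq, comp_fst_eq]
    exact Hom.ext (funext fun _ => CartesianLeftLinear.add_fst k _ _)
  add_snd f g := by
    rw [comp_snd_eq, comp_snd_eq, comp_snd_eq]
    exact Hom.ext (funext fun _ => CartesianLeftLinear.add_snd k _ _)
  smul_fst r f := by
    rw [comp_fst_eq, comp_fst_eq]
    exact Hom.ext (funext fun _ => CartesianLeftLinear.smul_fst _ _)
  smul_snd r f := by
    rw [comp_snd_eq, comp_snd_eq]
    exact Hom.ext (funext fun _ => CartesianLeftLinear.smul_snd _ _)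

/-- The Faà di Bruno category is a cartesian differential category. -/
noncomputable instance instCartesianDifferential : CartesianDifferential k (Faa k C) where
  D f := Hom.D f
  D_add f g := Hom.D_add f g
  D_smul r f := Hom.D_smul r f
  lift_add_D f x v w := by
    rw [lift_eq, lift_eq, lift_eq]
    exact Hom.pair_add_then_D f x v w
  lift_smul_D f r x v := by
    rw [lift_eq, lift_eq]
    exact Hom.pair_smul_then_D f r x v
  D_fst A B := (Hom.D_lin _ (isLinear_fst k A.obj B.obj)).trans
    ((comp_fst_eq (snd (A ⊗ B) (A ⊗ B))).trans
      (Hom.post_lin _ (isLinear_snd k (A.obj ⊗ B.obj) (A.obj ⊗ B.obj)) _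
        (isLinear_fst k A.obj B.obj))).symm
  D_snd A B := (Hom.D_lin _ (isLinear_snd k A.obj B.obj)).trans
    ((comp_snd_eq (snd (A ⊗ B) (A ⊗ B))).trans
      (Hom.post_lin _ (isLinear_snd k (A.obj ⊗ B.obj) (A.obj ⊗ B.obj)) _
        (isLinear_snd k A.obj B.obj))).symm
  D_id A := (Hom.D_lin _ (isLinear_id k A.obj)).trans
    (Hom.ext (congrArg linComp (Category.comp_id (snd A.obj A.obj))))
  D_comp f g := (Hom.D_then f g).trans (congrArg (fun t => Hom.then t (Hom.D g))
    ((congrArg (fun t => Hom.pair t (Hom.D f)) (Hom.lin_then _ (isLinear_fst k _ _) f).symm).trans (lift_eq _ _).symm))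
  D_D_linear f x r v := by
    rw [lift_eq, lift_eq, lift_eq, lift_eq]
    exact Hom.D_D_linear f x r v
  D_D_symm f x r s := by
    rw [lift_eq, lift_eq, lift_eq, lift_eq, lift_eq, lift_eq]
    exact Hom.D_D_symm f x r s

/-- The projection `ε` from the Faà di Bruno category of `C` to `C`: the identity on objects,
and `f ↦ f⁽⁰⁾` on morphisms, where `X × X⁰` is identified with `X`. -/
noncomputable def ε : CartLinFunctor k (Faa k C) C where
  obj X := X.obj
  map {X _} f := app (Hom.comp f 0) (𝟙 X.obj) Fin.elim0
  map_id X := (app_linComp_zero (𝟙 X.obj) (𝟙 X.obj) Fin.elim0).trans (Category.comp_id _)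
  map_comp {X Y Z} f g := by
    have h := Hom.then_eval_zero f g (𝟙 X.obj) Fin.elim0
    rw [Hom.eval_fin, Hom.eval_fin, Hom.eval_fin] at h
    refine h.trans ?_
    rw [comp_app, Category.comp_id]
    congr 1
    exact Subsingleton.elim _ _
  map_add f g := LeftAdditive.comp_add _ _ _
  map_smul r f := LeftLinear.comp_smul (k := k) _ r _
  obj_unit := rfl
  obj_tensor _ _ := rfl
  map_fst X Y := app_linComp_zero (fst X.obj Y.obj) (𝟙 _) Fin.elim0
  map_snd X Y := app_linComp_zero (snd X.obj Y.obj) (𝟙 _) Fin.elim0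

end Faa

/-- The Faà di Bruno category of a bundled cartesian left-`k`-linear category. -/
noncomputable def CartLinCat.faa {k : Type w} [CommSemiring k] (A : CartLinCat.{w, v, u} k) :
    CartDiffCat.{w, v, u} k where
  carrier := Faa k A.carrier

/-- The projection `ε`, as a morphism of cartesian left-`k`-linear categories. -/
noncomputable def CartLinCat.counit {k : Type w} [CommSemiring k] (A : CartLinCat.{w, v, u} k) :
    (CartDiffCat.forget k).obj A.faa ⟶ A :=
  Faa.ε k A.carrier

/-!
The Faà di Bruno category of `A` is cofree on `A` because a map of cartesian differential
categories into it is determined by, and can be rebuilt from, its composite with `ε`. Let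
`F : B → A` be a strict map from a cartesian differential category `B`.

A map `f` of `B` has iterated derivatives
`f⁽ⁿ⁺¹⁾ (x, v₀, …, vₙ) = (D f)⁽ⁿ⁾ ((x, v₀), (v₁, 0), …, (vₙ, 0))`, and the lift of `F` sends `f`
to the family of their images under `F` (`CartLinFunctor.deriv`, `CartLinFunctor.jet`). They are
evaluated at generalized elements `x, vᵢ : Z ⟶ F X` of `A`, so that the identification of
`F (X ⊗ Y)` with `F X ⊗ F Y` is hidden in the pairing `CartLinFunctor.pr`. Each law of a cartesian
differential category is an equation `l ≫ g = l' ≫ g` or a similar one, in which `l` and `l'` are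
changes of variables with `D l (x, v) = l v`. Such maps pass through iterated derivatives
(`CartLinFunctor.deriv_comp_left`), so each law may be differentiated any number of times. In this
way the linearity of `D f` in its second argument gives multilinearity of `f⁽ⁿ⁾`, the symmetry of
`D D f` gives its invariance under adjacent transpositions, and these two laws together with
`D D f (x, r, 0, v) = D f (x, v)` give the formula for the differential of a Faà di Bruno morphism
(`CartLinFunctor.deriv_D`).

In the Faà di Bruno category too, the `(n + 1)`-st component of a morphism is read off from the
`n`-th component of its differential (`FaaDiBruno.Hom.eval_succ`). Hence functoriality of the lift
(`CartLinFunctor.jet_comp`) follows by induction on `n` from the chain rules for `D` in `B` and in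
the Faà di Bruno category, without a computation with partitions; and a strict map `G` which
commutes with `D` has as its components the iterated derivatives along `G ≫ ε` (`Faa.map_eval`),
which is uniqueness. Existence and uniqueness amount to natural bijections of hom-sets, that is,
the adjunction.
-/

/-! ### Pairings along a strict map -/

namespace CartLinFunctor

open FaaDiBruno

section Pairing

variable {k : Type w} [CommSemiring k]
  {B : Type u₂} [Category.{v₂} B] [CartesianMonoidalCategory B] [LeftAdditive B] [LeftLinear k B]
  {A : Type u₁} [Category.{v₁} A] [CartesianMonoidalCategory A] [LeftAdditive A] [LeftLinear k A]
  (F : CartLinFunctor k B A) {X Y W : B} {Z Z' : A}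

/-- The pairing of generalized elements of `F X` and `F Y`, as a generalized element of
`F (X ⊗ Y)`, an object which is equal, but not definitionally, to `F X ⊗ F Y`. -/
def pr (x : Z ⟶ F.obj X) (y : Z ⟶ F.obj Y) : Z ⟶ F.obj (X ⊗ Y) :=
  lift x y ≫ eqToHom (F.obj_tensor X Y).symm

@[simp]
theorem pr_map_fst (x : Z ⟶ F.obj X) (y : Z ⟶ F.obj Y) : F.pr x y ≫ F.map (fst X Y) = x := by
  simp [pr, F.map_fst]

@[simp]
theorem pr_map_snd (x : Z ⟶ F.obj X) (y : Z ⟶ F.obj Y) : F.pr x y ≫ F.map (snd X Y) = y := by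
  simp [pr, F.map_snd]

@[simp]
theorem pr_map_fst_assoc (x : Z ⟶ F.obj X) (y : Z ⟶ F.obj Y) (h : F.obj X ⟶ Z') :
    F.pr x y ≫ F.map (fst X Y) ≫ h = x ≫ h := by
  rw [← Category.assoc, pr_map_fst]

@[simp]
theorem pr_map_snd_assoc (x : Z ⟶ F.obj X) (y : Z ⟶ F.obj Y) (h : F.obj Y ⟶ Z') :
    F.pr x y ≫ F.map (snd X Y) ≫ h = y ≫ h := by
  rw [← Category.assoc, pr_map_snd]

theorem comp_eqToHom_eq_lift (a : Z ⟶ F.obj (X ⊗ Y)) :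
    a ≫ eqToHom (F.obj_tensor X Y) = lift (a ≫ F.map (fst X Y)) (a ≫ F.map (snd X Y)) := by
  ext <;> simp [F.map_fst, F.map_snd]

theorem pr_eta (a : Z ⟶ F.obj (X ⊗ Y)) :
    F.pr (a ≫ F.map (fst X Y)) (a ≫ F.map (snd X Y)) = a := by
  rw [pr, ← comp_eqToHom_eq_lift]
  simp

theorem pr_ext {a b : Z ⟶ F.obj (X ⊗ Y)} (h₁ : a ≫ F.map (fst X Y) = b ≫ F.map (fst X Y))
    (h₂ : a ≫ F.map (snd X Y) = b ≫ F.map (snd X Y)) : a = b := by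
  rw [← F.pr_eta a, ← F.pr_eta b, h₁, h₂]

theorem comp_pr (h : Z' ⟶ Z) (x : Z ⟶ F.obj X) (y : Z ⟶ F.obj Y) :
    h ≫ F.pr x y = F.pr (h ≫ x) (h ≫ y) := by
  simp only [pr, ← comp_lift, Category.assoc]

@[simp]
theorem comp_map_lift (a : Z ⟶ F.obj W) (f : W ⟶ X) (g : W ⟶ Y) :
    a ≫ F.map (lift f g) = F.pr (a ≫ F.map f) (a ≫ F.map g) := by
  apply F.pr_ext <;> simp [← F.map_comp]

@[simp]
theorem comp_map_lift_assoc (a : Z ⟶ F.obj W) (f : W ⟶ X) (g : W ⟶ Y)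
    (h : F.obj (X ⊗ Y) ⟶ Z') :
    a ≫ F.map (lift f g) ≫ h = F.pr (a ≫ F.map f) (a ≫ F.map g) ≫ h := by
  rw [← Category.assoc, comp_map_lift]

theorem map_zero (X Y : B) : F.map (0 : X ⟶ Y) = 0 := by
  simpa using F.map_smul (0 : k) (0 : X ⟶ Y)

variable [CartesianLeftLinear k A]

theorem isLinear_eqToHom {P Q : A} (h : P = Q) : IsLinear k (eqToHom h) := by
  subst h
  exact isLinear_id k P

theorem pr_add (a a' : Z ⟶ F.obj X) (b b' : Z ⟶ F.obj Y) :
    F.pr (a + a') (b + b') = F.pr a b + F.pr a' b' := by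
  rw [pr, lift_add k, (isLinear_eqToHom (k := k) _).add]
  rfl

theorem pr_smul (r : k) (a : Z ⟶ F.obj X) (b : Z ⟶ F.obj Y) :
    F.pr (r • a) (r • b) = r • F.pr a b := by
  rw [pr, lift_smul, (isLinear_eqToHom (k := k) _).smul]
  rfl

@[simp]
theorem pr_zero : F.pr (0 : Z ⟶ F.obj X) (0 : Z ⟶ F.obj Y) = 0 := by
  simpa using F.pr_smul (0 : k) (0 : Z ⟶ F.obj X) (0 : Z ⟶ F.obj Y)

end Pairing

end CartLinFunctor

/-! ### Maps which are linear for the differential -/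

namespace CartesianDifferential

variable (k : Type w) [CommSemiring k]
  {B : Type u₂} [Category.{v₂} B] [CartesianMonoidalCategory B] [LeftAdditive B] [LeftLinear k B]
  [CartesianLeftLinear k B] [CartesianDifferential k B] {X Y T : B}

/-- A map `l` is linear for the differential if its derivative is constant with value `l`, that
is, `D l (x, v) = l v`. -/
def DLinear (l : X ⟶ Y) : Prop := D k l = snd X X ≫ l

theorem D_lift (f : X ⟶ Y) (g : X ⟶ T) : D k (lift f g) = lift (D k f) (D k g) := by
  have h₁ := D_comp (k := k) (lift f g) (fst Y T)
  have h₂ := D_comp (k := k) (lift f g) (snd Y T)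
  rw [lift_fst, D_fst, lift_snd_assoc] at h₁
  rw [lift_snd, D_snd, lift_snd_assoc] at h₂
  rw [h₁, h₂]
  ext <;> simp

theorem D_zero (X Y : B) : D k (0 : X ⟶ Y) = 0 := by
  simpa using D_smul (0 : k) (0 : X ⟶ Y)

variable {k}

theorem dLinear_id (X : B) : DLinear k (𝟙 X) := by
  rw [DLinear, D_id, Category.comp_id]

theorem dLinear_fst (X Y : B) : DLinear k (fst X Y) := D_fst X Y

theorem dLinear_snd (X Y : B) : DLinear k (snd X Y) := D_snd X Y

theorem dLinear_zero (X Y : B) : DLinear k (0 : X ⟶ Y) := by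
  rw [DLinear, D_zero, LeftAdditive.comp_zero]

theorem DLinear.comp {l : X ⟶ Y} {m : Y ⟶ T} (hl : DLinear k l) (hm : DLinear k m) :
    DLinear k (l ≫ m) := by
  rw [DLinear, D_comp, hm, lift_snd_assoc, hl, Category.assoc]

theorem DLinear.lift {l : X ⟶ Y} {m : X ⟶ T} (hl : DLinear k l) (hm : DLinear k m) :
    DLinear k (lift l m) := by
  rw [DLinear, D_lift, hl, hm, comp_lift]

theorem DLinear.add {l m : X ⟶ Y} (hl : DLinear k l) (hm : DLinear k m) :
    DLinear k (l + m) := by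
  rw [DLinear, D_add, hl, hm, LeftAdditive.comp_add]

theorem DLinear.smul {l : X ⟶ Y} (r : k) (hl : DLinear k l) : DLinear k (r • l) := by
  rw [DLinear, D_smul, hl, LeftLinear.comp_smul]

theorem DLinear.D {l : X ⟶ Y} (hl : DLinear k l) : DLinear k (D k l) := by
  rw [hl]
  exact (dLinear_snd X X).comp hl

end CartesianDifferential

/-! ### Iterated derivatives along a strict map -/

namespace CartLinFunctor

open FaaDiBruno CartesianDifferential

section Derivatives

variable {k : Type w} [CommSemiring k]
  {B : Type u₂} [Category.{v₂} B] [CartesianMonoidalCategory B] [LeftAdditive B] [LeftLinear k B]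
  [CartesianLeftLinear k B] [CartesianDifferential k B]
  {A : Type u₁} [Category.{v₁} A] [CartesianMonoidalCategory A] [LeftAdditive A] [LeftLinear k A]
  (F : CartLinFunctor k B A) {X Y T : B} {Z Z' : A}

/-- The `n`-th derivative of `f` at `x`, applied to `v₁, …, vₙ`, evaluated along `F`. It is given
by `f⁽ⁿ⁺¹⁾ (x, v₀, …, vₙ) = (D f)⁽ⁿ⁾ ((x, v₀), (v₁, 0), …, (vₙ, 0))`. -/
def deriv : ∀ (n : ℕ) {X Y : B} (_ : X ⟶ Y) {Z : A} (_ : Z ⟶ F.obj X)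
    (_ : Fin n → (Z ⟶ F.obj X)), Z ⟶ F.obj Y
  | 0, _, _, f, _, x, _ => x ≫ F.map f
  | n + 1, _, _, f, _, x, v => deriv n (D k f) (F.pr x (v 0)) fun i => F.pr (v i.succ) 0

theorem deriv_zero (f : X ⟶ Y) (x : Z ⟶ F.obj X) (v : Fin 0 → (Z ⟶ F.obj X)) :
    F.deriv 0 f x v = x ≫ F.map f := rfl

theorem deriv_succ {n : ℕ} (f : X ⟶ Y) (x : Z ⟶ F.obj X) (v : Fin (n + 1) → (Z ⟶ F.obj X)) :
    F.deriv (n + 1) f x v = F.deriv n (D k f) (F.pr x (v 0)) fun i => F.pr (v i.succ) 0 := rfl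

theorem deriv_cons {n : ℕ} (f : X ⟶ Y) (x a : Z ⟶ F.obj X) (v : Fin n → (Z ⟶ F.obj X)) :
    F.deriv (n + 1) f x (Fin.cons a v : Fin (n + 1) → (Z ⟶ F.obj X)) =
      F.deriv n (D k f) (F.pr x a) fun i => F.pr (v i) 0 := rfl

theorem comp_deriv {n : ℕ} (h : Z' ⟶ Z) (f : X ⟶ Y) (x : Z ⟶ F.obj X)
    (v : Fin n → (Z ⟶ F.obj X)) :
    h ≫ F.deriv n f x v = F.deriv n f (h ≫ x) fun i => h ≫ v i := by
  induction n generalizing X with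
  | zero => simp [deriv_zero]
  | succ n ih => simp only [deriv_succ, ih, comp_pr, LeftAdditive.comp_zero]

theorem deriv_add {n : ℕ} (f g : X ⟶ Y) (x : Z ⟶ F.obj X) (v : Fin n → (Z ⟶ F.obj X)) :
    F.deriv n (f + g) x v = F.deriv n f x v + F.deriv n g x v := by
  induction n generalizing X with
  | zero => simp only [deriv_zero, F.map_add, LeftAdditive.comp_add]
  | succ n ih => simp only [deriv_succ, D_add, ih]

theorem deriv_smul {n : ℕ} (r : k) (f : X ⟶ Y) (x : Z ⟶ F.obj X)
    (v : Fin n → (Z ⟶ F.obj X)) : F.deriv n (r • f) x v = r • F.deriv n f x v := by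
  induction n generalizing X with
  | zero => simp only [deriv_zero, F.map_smul, LeftLinear.comp_smul]
  | succ n ih => simp only [deriv_succ, D_smul, ih]

theorem pr_zero_comp_D (f : X ⟶ Y) (x : Z ⟶ F.obj X) :
    F.pr x 0 ≫ F.map (D k f) = 0 := by
  have h := congrArg (x ≫ F.map ·) (lift_smul_D f (0 : k) (𝟙 X) (𝟙 X))
  simpa [map_zero, LeftAdditive.comp_zero] using h

theorem zero_comp_map {l : X ⟶ Y} (hl : DLinear k l) : (0 : Z ⟶ F.obj X) ≫ F.map l = 0 := by
  rw [← F.pr_zero_comp_D l (0 : Z ⟶ F.obj X), hl, F.map_comp, pr_map_snd_assoc]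

variable [CartesianLeftLinear k A]

/-- Maps which are linear for the differential pass through iterated derivatives. -/
theorem deriv_comp_left {n : ℕ} {l : X ⟶ Y} (hl : DLinear k l) (g : Y ⟶ T) (x : Z ⟶ F.obj X)
    (v : Fin n → (Z ⟶ F.obj X)) :
    F.deriv n (l ≫ g) x v = F.deriv n g (x ≫ F.map l) fun i => v i ≫ F.map l := by
  induction n generalizing X Y with
  | zero => simp [deriv_zero]
  | succ n ih =>
    rw [deriv_succ, deriv_succ, D_comp, hl,
      ih (((dLinear_fst X X).comp hl).lift ((dLinear_snd X X).comp hl))]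
    simp only [comp_map_lift, F.map_comp, pr_map_fst_assoc, pr_map_snd_assoc, F.zero_comp_map hl]

theorem deriv_fst_comp {n : ℕ} (g : X ⟶ T) (x : Z ⟶ F.obj X) (y : Z ⟶ F.obj Y)
    (u : Fin n → (Z ⟶ F.obj X)) (v : Fin n → (Z ⟶ F.obj Y)) :
    F.deriv n (fst X Y ≫ g) (F.pr x y) (fun i => F.pr (u i) (v i)) = F.deriv n g x u := by
  simp [F.deriv_comp_left (dLinear_fst (k := k) X Y)]

theorem deriv_lift {n : ℕ} (f : X ⟶ Y) (g : X ⟶ T) (x : Z ⟶ F.obj X)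
    (v : Fin n → (Z ⟶ F.obj X)) :
    F.deriv n (lift f g) x v = F.pr (F.deriv n f x v) (F.deriv n g x v) := by
  induction n generalizing X with
  | zero => simp [deriv_zero]
  | succ n ih => simp only [deriv_succ, D_lift, ih]

/-- The derivatives of a map which is linear for the differential. -/
theorem deriv_of_dLinear {n : ℕ} {l : X ⟶ Y} (hl : DLinear k l) (x : Z ⟶ F.obj X)
    (v : Fin n → (Z ⟶ F.obj X)) : F.deriv n l x v = app (linComp (F.map l) n) x v := by
  match n with
  | 0 => rw [deriv_zero, app_linComp_zero]
  | 1 => rw [deriv_succ, deriv_zero, hl, F.map_comp, pr_map_snd_assoc, app_linComp_one]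
  | n + 2 =>
    rw [app_linComp_add_two]
    induction n generalizing X with
    | zero =>
      rw [deriv_succ, deriv_succ, deriv_zero, hl.D, hl, F.map_comp, F.map_comp, pr_map_snd_assoc,
        pr_map_snd_assoc, F.zero_comp_map hl]
    | succ n ih => rw [deriv_succ, ih hl.D]

/-- Additivity of `D f` in its second argument, differentiated `n` times. -/
theorem deriv_D_add {n : ℕ} (f : X ⟶ Y) (x a b : Z ⟶ F.obj X) (u v w : Fin n → (Z ⟶ F.obj X)) :
    F.deriv n (D k f) (F.pr x (a + b)) (fun i => F.pr (u i) (v i + w i)) =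
      F.deriv n (D k f) (F.pr x a) (fun i => F.pr (u i) (v i)) +
        F.deriv n (D k f) (F.pr x b) (fun i => F.pr (u i) (w i)) := by
  -- The law is differentiated at the universal triple, the three projections of `X ⊗ (X ⊗ X)`.
  have hx := dLinear_fst (k := k) X (X ⊗ X)
  have ha := (dLinear_snd (k := k) X (X ⊗ X)).comp (dLinear_fst X X)
  have hb := (dLinear_snd (k := k) X (X ⊗ X)).comp (dLinear_snd X X)
  have h := congrArg
    (fun g => F.deriv n g (F.pr x (F.pr a b)) fun i => F.pr (u i) (F.pr (v i) (w i)))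
    (lift_add_D (k := k) f (fst X (X ⊗ X)) (snd X (X ⊗ X) ≫ fst X X) (snd X (X ⊗ X) ≫ snd X X))
  simpa [deriv_add, F.deriv_comp_left (hx.lift (ha.add hb)), F.deriv_comp_left (hx.lift ha),
    F.deriv_comp_left (hx.lift hb), F.map_add, LeftAdditive.comp_add] using h

/-- Homogeneity of `D f` in its second argument, differentiated `n` times. -/
theorem deriv_D_smul {n : ℕ} (f : X ⟶ Y) (r : k) (x a : Z ⟶ F.obj X)
    (u v : Fin n → (Z ⟶ F.obj X)) :
    F.deriv n (D k f) (F.pr x (r • a)) (fun i => F.pr (u i) (r • v i)) =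
      r • F.deriv n (D k f) (F.pr x a) (fun i => F.pr (u i) (v i)) := by
  have hx := dLinear_fst (k := k) X X
  have ha := dLinear_snd (k := k) X X
  have h := congrArg (fun g => F.deriv n g (F.pr x a) fun i => F.pr (u i) (v i))
    (lift_smul_D f r (fst X X) (snd X X))
  simpa [deriv_smul, F.deriv_comp_left (hx.lift (ha.smul r)), F.deriv_comp_left (hx.lift ha),
    F.map_smul, LeftLinear.comp_smul] using h

/-- The law `D D f (x, r, 0, w) = D f (x, w)`, differentiated `n` times. -/
theorem deriv_D_D_linear {n : ℕ} (f : X ⟶ Y) (x r w : Z ⟶ F.obj X)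
    (xs rs ws : Fin n → (Z ⟶ F.obj X)) :
    F.deriv n (D k (D k f)) (F.pr (F.pr x r) (F.pr 0 w))
        (fun i => F.pr (F.pr (xs i) (rs i)) (F.pr 0 (ws i))) =
      F.deriv n (D k f) (F.pr x w) fun i => F.pr (xs i) (ws i) := by
  have hx := dLinear_fst (k := k) X (X ⊗ X)
  have hr := (dLinear_snd (k := k) X (X ⊗ X)).comp (dLinear_fst X X)
  have hw := (dLinear_snd (k := k) X (X ⊗ X)).comp (dLinear_snd X X)
  have h0 := dLinear_zero (k := k) (X ⊗ (X ⊗ X)) X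
  have h := congrArg
    (fun g => F.deriv n g (F.pr x (F.pr r w)) fun i => F.pr (xs i) (F.pr (rs i) (ws i)))
    (D_D_linear (k := k) f (fst X (X ⊗ X)) (snd X (X ⊗ X) ≫ fst X X) (snd X (X ⊗ X) ≫ snd X X))
  simpa [F.deriv_comp_left ((hx.lift hr).lift (h0.lift hw)), F.deriv_comp_left (hx.lift hw),
    map_zero, LeftAdditive.comp_zero] using h

/-- The law `D D f (x, r, s, 0) = D D f (x, s, r, 0)`, differentiated `n` times. -/
theorem deriv_D_D_symm {n : ℕ} (f : X ⟶ Y) (x r s : Z ⟶ F.obj X)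
    (xs rs ss : Fin n → (Z ⟶ F.obj X)) :
    F.deriv n (D k (D k f)) (F.pr (F.pr x r) (F.pr s 0))
        (fun i => F.pr (F.pr (xs i) (rs i)) (F.pr (ss i) 0)) =
      F.deriv n (D k (D k f)) (F.pr (F.pr x s) (F.pr r 0))
        (fun i => F.pr (F.pr (xs i) (ss i)) (F.pr (rs i) 0)) := by
  have hx := dLinear_fst (k := k) X (X ⊗ X)
  have hr := (dLinear_snd (k := k) X (X ⊗ X)).comp (dLinear_fst X X)
  have hs := (dLinear_snd (k := k) X (X ⊗ X)).comp (dLinear_snd X X)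
  have h0 := dLinear_zero (k := k) (X ⊗ (X ⊗ X)) X
  have h := congrArg
    (fun g => F.deriv n g (F.pr x (F.pr r s)) fun i => F.pr (xs i) (F.pr (rs i) (ss i)))
    (D_D_symm (k := k) f (fst X (X ⊗ X)) (snd X (X ⊗ X) ≫ fst X X) (snd X (X ⊗ X) ≫ snd X X))
  simpa [F.deriv_comp_left ((hx.lift hr).lift (hs.lift h0)),
    F.deriv_comp_left ((hx.lift hs).lift (hr.lift h0)), map_zero, LeftAdditive.comp_zero] using h

theorem deriv_update_add {n : ℕ} (f : X ⟶ Y) (x : Z ⟶ F.obj X) (v : Fin n → (Z ⟶ F.obj X))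
    (i : Fin n) (a b : Z ⟶ F.obj X) :
    F.deriv n f x (Function.update v i (a + b)) =
      F.deriv n f x (Function.update v i a) + F.deriv n f x (Function.update v i b) := by
  induction n generalizing X with
  | zero => exact i.elim0
  | succ n ih =>
    induction i using Fin.cases with
    | zero =>
      simpa [deriv_succ] using
        F.deriv_D_add f x a b (fun i => v i.succ) (fun _ => 0) fun _ => 0
    | succ i =>
      have key (c : Z ⟶ F.obj X) : (fun j : Fin n => F.pr (Function.update v i.succ c j.succ) 0) =
          Function.update (fun j : Fin n => F.pr (v j.succ) (0 : Z ⟶ F.obj X)) i (F.pr c 0) := by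
        funext j
        simp only [Function.update_apply, Fin.succ_inj]
        split_ifs <;> rfl
      have hab : F.pr (a + b) (0 : Z ⟶ F.obj X) = F.pr a 0 + F.pr b 0 := by
        rw [← pr_add, add_zero]
      simp only [deriv_succ, key, hab, ih, Function.update_of_ne (Fin.succ_ne_zero i).symm]

theorem deriv_update_smul {n : ℕ} (f : X ⟶ Y) (x : Z ⟶ F.obj X) (v : Fin n → (Z ⟶ F.obj X))
    (i : Fin n) (r : k) (a : Z ⟶ F.obj X) :
    F.deriv n f x (Function.update v i (r • a)) =
      r • F.deriv n f x (Function.update v i a) := by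
  induction n generalizing X with
  | zero => exact i.elim0
  | succ n ih =>
    induction i using Fin.cases with
    | zero =>
      simpa [deriv_succ] using F.deriv_D_smul f r x a (fun i => v i.succ) fun _ => 0
    | succ i =>
      have key (c : Z ⟶ F.obj X) : (fun j : Fin n => F.pr (Function.update v i.succ c j.succ) 0) =
          Function.update (fun j : Fin n => F.pr (v j.succ) (0 : Z ⟶ F.obj X)) i (F.pr c 0) := by
        funext j
        simp only [Function.update_apply, Fin.succ_inj]
        split_ifs <;> rfl
      have ha : F.pr (r • a) (0 : Z ⟶ F.obj X) = r • F.pr a 0 := by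
        rw [← pr_smul, smul_zero]
      simp only [deriv_succ, key, ha, ih, Function.update_of_ne (Fin.succ_ne_zero i).symm]

/-- The second derivative is symmetric, also after further differentiation. -/
theorem deriv_cons_cons_comm {n : ℕ} (f : X ⟶ Y) (x a b : Z ⟶ F.obj X)
    (v : Fin n → (Z ⟶ F.obj X)) :
    F.deriv (n + 2) f x (Fin.cons a (Fin.cons b v) : Fin (n + 2) → (Z ⟶ F.obj X)) =
      F.deriv (n + 2) f x (Fin.cons b (Fin.cons a v) : Fin (n + 2) → (Z ⟶ F.obj X)) := by
  simpa [deriv_succ] using F.deriv_D_D_symm f x a b v (fun _ => 0) fun _ => 0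

theorem deriv_comp_swap {n : ℕ} (f : X ⟶ Y) (x : Z ⟶ F.obj X)
    (v : Fin (n + 1) → (Z ⟶ F.obj X)) (i : Fin n) :
    F.deriv (n + 1) f x (v ∘ Equiv.swap i.castSucc i.succ) = F.deriv (n + 1) f x v := by
  induction n generalizing X with
  | zero => exact i.elim0
  | succ n ih =>
    induction i using Fin.cases with
    | zero =>
      have h := F.deriv_cons_cons_comm f x (v 1) (v 0) fun i => v i.succ.succ
      convert h using 2
      · funext j
        refine Fin.cases ?_ (Fin.cases ?_ fun j => ?_) j
        · simp
        · simp
        · rw [Function.comp_apply, Equiv.swap_apply_of_ne_of_ne (by simp [Fin.ext_iff])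
            (by simp [Fin.ext_iff])]
          rfl
      · funext j
        refine Fin.cases ?_ (Fin.cases ?_ fun j => ?_) j <;> rfl
    | succ i =>
      refine Eq.trans ?_ (ih (D k f) (F.pr x (v 0)) (fun j => F.pr (v j.succ) 0) i)
      rw [deriv_succ (n := n + 1)]
      refine congrArg₂ (F.deriv (n + 1) (D k f)) ?_ ?_
      · rw [Function.comp_apply, Equiv.swap_apply_of_ne_of_ne (by simp [Fin.ext_iff])
          (by simp [Fin.ext_iff])]
      · funext j
        simp only [Function.comp_apply]
        rw [show Equiv.swap i.succ.castSucc i.succ.succ j.succ =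
            (Equiv.swap i.castSucc i.succ j).succ by
          rw [← Fin.succ_castSucc]
          exact (Fin.succ_injective _).swap_apply _ _ _]

theorem deriv_comp_perm {n : ℕ} (f : X ⟶ Y) (x : Z ⟶ F.obj X) (v : Fin n → (Z ⟶ F.obj X))
    (σ : Equiv.Perm (Fin n)) : F.deriv n f x (v ∘ σ) = F.deriv n f x v := by
  match n with
  | 0 => rw [Subsingleton.elim (v ∘ σ) v]
  | n + 1 =>
    have hσ : σ ∈ Submonoid.closure
        (Set.range fun i : Fin n => Equiv.swap i.castSucc i.succ) := by
      rw [Equiv.Perm.mclosure_swap_castSucc_succ]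
      trivial
    induction hσ using Submonoid.closure_induction generalizing v with
    | mem σ h =>
      obtain ⟨i, rfl⟩ := h
      exact F.deriv_comp_swap f x v i
    | one => rfl
    | mul σ τ _ _ hσ hτ => exact (hτ (v ∘ σ)).trans (hσ v)

/-- The derivatives of `D f` are given by the formula for the differential of a Faà di Bruno
morphism. The proof is by induction on `n`: `D D f ((x, y), (u₀, v₀))` is additive in the pair
`(u₀, v₀) = (u₀, 0) + (0, v₀)`. The summand with `(0, v₀)` is `D f (x, v₀)`; in the other one `y`
and `u₀` may be exchanged, which brings it to the form of the inductive hypothesis for `D f`. -/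
theorem deriv_D {n : ℕ} (f : X ⟶ Y) (x y : Z ⟶ F.obj X) (u v : Fin n → (Z ⟶ F.obj X)) :
    F.deriv n (D k f) (F.pr x y) (fun i => F.pr (u i) (v i)) =
      F.deriv (n + 1) f x (Fin.cons y u : Fin (n + 1) → (Z ⟶ F.obj X)) +
        ∑ i, F.deriv n f x (Function.update u i (v i)) := by
  induction n generalizing X with
  | zero =>
    rw [Finset.univ_eq_empty, Finset.sum_empty, add_zero]
    rfl
  | succ n ih =>
    have hadd : F.pr (u 0) (v 0) = F.pr (u 0) 0 + F.pr 0 (v 0) := by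
      rw [← pr_add, add_zero, zero_add]
    have h1 := F.deriv_D_add (D k f) (F.pr x y) (F.pr (u 0) 0) (F.pr 0 (v 0))
      (fun i : Fin n => F.pr (u i.succ) (v i.succ)) (fun _ => 0) fun _ => 0
    have h2 := F.deriv_D_D_linear f x y (v 0) (fun i : Fin n => u i.succ)
      (fun i => v i.succ) fun _ => 0
    have h3 := F.deriv_D_D_symm f x y (u 0) (fun i : Fin n => u i.succ)
      (fun i => v i.succ) fun _ => 0
    have h4 := ih (D k f) (F.pr x (u 0)) (F.pr y 0) (fun i : Fin n => F.pr (u i.succ) 0)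
      fun i => F.pr (v i.succ) 0
    simp only [pr_zero, add_zero] at h1 h2 h3
    rw [deriv_succ, hadd, h1, h2, h3, h4, Fin.sum_univ_succ, add_assoc]
    congr 1
    · have h5 : (Fin.cons (F.pr y 0) fun i => F.pr (u i.succ) 0 :
          Fin (n + 1) → (Z ⟶ F.obj (X ⊗ X))) =
          fun i => F.pr ((Fin.cons y fun i => u i.succ : Fin (n + 1) → (Z ⟶ F.obj X)) i) 0 := by
        funext j
        refine Fin.cases ?_ (fun j => ?_) j <;> rfl
      have hu : (Fin.cons (u 0) fun i => u i.succ : Fin (n + 1) → (Z ⟶ F.obj X)) = u :=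
        Fin.cons_self_tail u
      rw [h5, ← deriv_cons, deriv_cons_cons_comm, hu]
    · rw [add_comm]
      refine congrArg₂ (· + ·) ?_ ?_
      · simp [deriv_succ]
      · refine Finset.sum_congr rfl fun i _ => ?_
        rw [deriv_succ]
        congr 1
        funext j
        simp only [Function.update_apply, Fin.succ_inj]
        split_ifs <;> rfl

end Derivatives

end CartLinFunctor

/-! ### The Faà di Bruno morphism of iterated derivatives -/

namespace CartLinFunctor

open FaaDiBruno CartesianDifferential

section Jet

variable {k : Type w} [CommSemiring k]
  {B : Type u₂} [Category.{v₂} B] [CartesianMonoidalCategory B] [LeftAdditive B] [LeftLinear k B]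
  [CartesianLeftLinear k B] [CartesianDifferential k B]
  {A : Type u₁} [Category.{v₁} A] [CartesianMonoidalCategory A] [LeftAdditive A] [LeftLinear k A]
  [CartesianLeftLinear k A]
  (F : CartLinFunctor k B A) {X Y T : B} {Z : A}

theorem _root_.FaaDiBruno.Hom.pre_eqToHom_eval {P Q R : A} (h : P = Q) (f : Hom k Q R)
    {ι : Type*} [Finite ι] (x : Z ⟶ Q) (v : ι → (Z ⟶ Q)) :
    (f.pre (eqToHom h) (isLinear_eqToHom h)).eval (x ≫ eqToHom h.symm)
      (fun i => v i ≫ eqToHom h.symm) = f.eval x v := by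
  subst h
  simp [Hom.pre_eval]

theorem app_deriv {n : ℕ} (f : X ⟶ Y) (x : Z ⟶ F.obj X) (v : Fin n → (Z ⟶ F.obj X)) :
    app (F.deriv n f (fst (F.obj X) (power (F.obj X) n))
      fun i => snd (F.obj X) (power (F.obj X) n) ≫ proj (F.obj X) n i) x v = F.deriv n f x v := by
  rw [app, comp_deriv]
  simp

/-- The Faà di Bruno morphism whose components are the iterated derivatives of `f`, evaluated
along `F`. -/
def jet (f : X ⟶ Y) : Hom k (F.obj X) (F.obj Y) where
  comp n := F.deriv n f (fst (F.obj X) (power (F.obj X) n))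
    fun i => snd (F.obj X) (power (F.obj X) n) ≫ proj (F.obj X) n i
  symm x v σ := by simp only [app_deriv, deriv_comp_perm]
  map_add x v i a b := by simp only [app_deriv, deriv_update_add]
  map_smul x v i r a := by simp only [app_deriv, deriv_update_smul]

theorem app_jet {n : ℕ} (f : X ⟶ Y) (x : Z ⟶ F.obj X) (v : Fin n → (Z ⟶ F.obj X)) :
    app ((F.jet f).comp n) x v = F.deriv n f x v :=
  F.app_deriv f x v

theorem jet_add (f g : X ⟶ Y) : F.jet (f + g) = F.jet f + F.jet g :=
  Hom.ext (funext fun _ => F.deriv_add _ _ _ _)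

theorem jet_smul (r : k) (f : X ⟶ Y) : F.jet (r • f) = r • F.jet f :=
  Hom.ext (funext fun _ => F.deriv_smul _ _ _ _)

theorem isLinear_map {l : X ⟶ Y} (hl : DLinear k l) : IsLinear k (F.map l) where
  add a b := by
    have h := F.deriv_D_add l 0 a b Fin.elim0 Fin.elim0 Fin.elim0
    simpa [deriv_zero, show D k l = _ from hl] using h
  smul r a := by
    have h := F.deriv_D_smul l r 0 a Fin.elim0 Fin.elim0
    simpa [deriv_zero, show D k l = _ from hl] using h

theorem jet_of_dLinear {l : X ⟶ Y} (hl : DLinear k l) :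
    F.jet l = Hom.lin (F.map l) (F.isLinear_map hl) :=
  Hom.ext_fin fun n Z x v => by
    rw [Hom.eval_fin, Hom.eval_fin, app_jet, F.deriv_of_dLinear hl]
    rfl

theorem jet_fst_comp_eval (g : X ⟶ T) {ι : Type*} [Finite ι] (x : Z ⟶ F.obj X) (y : Z ⟶ F.obj Y)
    (u : ι → (Z ⟶ F.obj X)) (v : ι → (Z ⟶ F.obj Y)) :
    (F.jet (fst X Y ≫ g)).eval (F.pr x y) (fun i => F.pr (u i) (v i)) = (F.jet g).eval x u := by
  simp only [Hom.eval, Function.comp_def, app_jet, deriv_fst_comp]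

theorem jet_lift_eval (f : X ⟶ Y) (g : X ⟶ T) {ι : Type*} [Finite ι] (x : Z ⟶ F.obj X)
    (v : ι → (Z ⟶ F.obj X)) :
    (F.jet (lift f g)).eval x v = F.pr ((F.jet f).eval x v) ((F.jet g).eval x v) := by
  simp only [Hom.eval, app_jet, deriv_lift]

theorem jet_D (f : X ⟶ Y) :
    F.jet (D k f) = (F.jet f).D.pre (eqToHom (F.obj_tensor X X)) (isLinear_eqToHom _) := by
  refine Hom.ext_fin fun n Z x v => ?_
  simp only [Hom.pre_eval, comp_eqToHom_eq_lift, Hom.D_eval_lift, diff_eq]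
  rw [(F.jet f).eval_congr (finSuccEquiv n).symm _ _
    (Fin.cons (x ≫ F.map (snd X X)) fun i => v i ≫ F.map (fst X X)) (by rintro (_ | i) <;> simp)]
  simp only [Hom.eval_fin, app_jet, ← deriv_D, pr_eta]

theorem jet_D_eval (f : X ⟶ Y) {ι : Type*} [Finite ι] (x y : Z ⟶ F.obj X)
    (u v : ι → (Z ⟶ F.obj X)) :
    (F.jet (D k f)).eval (F.pr x y) (fun i => F.pr (u i) (v i)) =
      (F.jet f).D.eval (lift x y) fun i => lift (u i) (v i) := by
  rw [jet_D]
  exact Hom.pre_eqToHom_eval _ _ _ _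

/-- The higher-order chain rule. It follows by induction from the chain rule
`D (f ≫ g) = (f π₀, D f) ≫ D g`, which holds in `B` as well as for Faà di Bruno morphisms. -/
theorem jet_comp_eval (n : ℕ) : ∀ {X Y T : B} {Z : A} (f : X ⟶ Y) (g : Y ⟶ T) (x : Z ⟶ F.obj X)
    (v : Fin n → (Z ⟶ F.obj X)),
    (F.jet (f ≫ g)).eval x v = ((F.jet f).then (F.jet g)).eval x v := by
  induction n with
  | zero =>
    intro X Y T Z f g x v
    rw [Hom.then_eval_zero]
    simp [app_jet, deriv_zero]
  | succ n ih =>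
    intro X Y T Z f g x v
    rw [Hom.eval_succ, Hom.eval_succ, Hom.D_then, ← jet_D_eval, D_comp, ih, Hom.then_eval,
      Hom.then_eval, chain, chain]
    refine Finset.sum_congr rfl fun s _ => ?_
    -- The base point of each summand is a value at the empty family.
    have h0 (P : A) (u : Fin 0 → (Z ⟶ P)) : u = Fin.elim0 := Subsingleton.elim _ _
    have h1 := F.jet_fst_comp_eval f x (v 0) (Fin.elim0 : Fin 0 → (Z ⟶ F.obj X)) Fin.elim0
    have h2 := F.jet_D_eval f x (v 0) (Fin.elim0 : Fin 0 → (Z ⟶ F.obj X)) Fin.elim0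
    rw [h0 _ fun i => _] at h1 h2
    rw [h0 _ fun i => lift _ _] at h2
    simp only [jet_lift_eval, jet_fst_comp_eval, jet_D_eval, h1, h2, Hom.tangent_eval, lift_fst,
      h0 _ fun i : Fin 0 => _]

theorem jet_comp (f : X ⟶ Y) (g : Y ⟶ T) : F.jet (f ≫ g) = (F.jet f).then (F.jet g) :=
  Hom.ext_fin fun n _ x v => F.jet_comp_eval n f g x v

end Jet

end CartLinFunctor

/-! ### The universal property -/

namespace Faa

open FaaDiBruno CartesianDifferential

section Lift

variable {k : Type w} [CommSemiring k]
  {A : Type u₁} [Category.{v₁} A] [CartesianMonoidalCategory A] [LeftAdditive A] [LeftLinear k A]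
  [CartesianLeftLinear k A]

theorem eqToHom_eq_lin {P Q : Faa k A} (h : P = Q) :
    (eqToHom h : P ⟶ Q) =
      Hom.lin (eqToHom (congrArg Faa.obj h)) (CartLinFunctor.isLinear_eqToHom _) := by
  subst h
  rfl

theorem eqToHom_comp {P Q R : Faa k A} (h : P = Q) (f : Q ⟶ R) :
    eqToHom h ≫ f =
      Hom.pre (eqToHom (congrArg Faa.obj h)) (CartLinFunctor.isLinear_eqToHom _) f := by
  rw [eqToHom_eq_lin]
  exact Hom.lin_then _ _ _

variable {B : Type u₂} [Category.{v₂} B] [CartesianMonoidalCategory B] [LeftAdditive B]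
  [LeftLinear k B] [CartesianLeftLinear k B] [CartesianDifferential k B]

/-- The strict map of cartesian differential categories induced by `F`: it sends a map to the
family of its iterated derivatives. -/
def desc (F : CartLinFunctor k B A) : CartDiffFunctor k B (Faa k A) where
  obj X := ⟨F.obj X⟩
  map f := F.jet f
  map_id X := by
    refine (F.jet_of_dLinear (dLinear_id X)).trans (Hom.ext ?_)
    exact congrArg linComp (F.map_id X)
  map_comp f g := F.jet_comp f g
  map_add f g := F.jet_add f g
  map_smul r f := F.jet_smul r f
  obj_unit := congrArg Faa.mk F.obj_unit
  obj_tensor X Y := congrArg Faa.mk (F.obj_tensor X Y)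
  map_fst X Y := by
    refine (F.jet_of_dLinear (dLinear_fst X Y)).trans ((eqToHom_comp _ _).trans ?_).symm
    refine (Hom.pre_lin _ _ (fst (F.obj X) (F.obj Y)) (isLinear_fst k _ _)).trans (Hom.ext ?_)
    exact congrArg linComp (F.map_fst X Y).symm
  map_snd X Y := by
    refine (F.jet_of_dLinear (dLinear_snd X Y)).trans ((eqToHom_comp _ _).trans ?_).symm
    refine (Hom.pre_lin _ _ (snd (F.obj X) (F.obj Y)) (isLinear_snd k _ _)).trans (Hom.ext ?_)
    exact congrArg linComp (F.map_snd X Y).symm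
  map_D f := (F.jet_D f).trans (eqToHom_comp _ _).symm

theorem desc_comp_ε (F : CartLinFunctor k B A) :
    (desc F).toCartLinFunctor.comp (ε k A) = F := by
  refine CartLinFunctor.ext rfl (heq_of_eq ?_)
  funext X Y f
  exact (F.app_jet f (𝟙 _) Fin.elim0).trans (Category.id_comp _)

/-- The components of the image of `f` under a strict map `G` of cartesian differential categories
are determined by the composite of `G` and `ε`: the `(n + 1)`-st component of a Faà di Bruno
morphism is part of the `n`-th component of its differential. -/
theorem map_eval (G : CartDiffFunctor k B (Faa k A)) (n : ℕ) : ∀ {X Y : B} (f : X ⟶ Y) {Z : A}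
    (x : Z ⟶ (G.obj X).obj) (v : Fin n → (Z ⟶ (G.obj X).obj)),
    Hom.eval (G.map f) x v = (G.toCartLinFunctor.comp (ε k A)).deriv n f x v := by
  induction n with
  | zero =>
    intro X Y f Z x v
    refine (Hom.eval_fin _ _ _).trans ?_
    refine Eq.trans ?_ (comp_app x _ (𝟙 _) Fin.elim0).symm
    rw [Category.comp_id]
    exact congrArg _ (Subsingleton.elim _ _)
  | succ n ih =>
    intro X Y f Z x v
    have hD := (G.map_D f).trans (eqToHom_comp _ _)
    have h := Hom.pre_eqToHom_eval (congrArg Faa.obj (G.obj_tensor X X)) (Hom.D (G.map f))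
      (lift x (v 0)) fun i : Fin n => lift (v i.succ) 0
    refine (Hom.eval_succ _ x v).trans (h.symm.trans (Eq.trans ?_ (ih (D k f) _ _)))
    exact congrArg (fun g => Hom.eval g (lift x (v 0) ≫ eqToHom _)
      fun i : Fin n => lift (v i.succ) 0 ≫ eqToHom _) hD.symm

/-- Every strict map of cartesian differential categories into the Faà di Bruno category is
induced by its composite with `ε`. -/
theorem desc_unique (G : CartDiffFunctor k B (Faa k A)) :
    desc (G.toCartLinFunctor.comp (ε k A)) = G := by
  refine CartDiffFunctor.ext rfl (heq_of_eq ?_)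
  funext X Y f
  refine Hom.ext_fin fun n Z x v => ?_
  exact (Hom.eval_fin _ _ _).trans
    ((CartLinFunctor.app_jet (G.toCartLinFunctor.comp (ε k A)) f x v).trans
      (map_eval G n f x v).symm)

end Lift

end Faa

/-- Strict maps from `B` to `A` correspond to strict maps of cartesian differential categories
from `B` to the Faà di Bruno category of `A`. -/
noncomputable def CartDiffCat.faaHomEquiv (k : Type w) [CommSemiring k]
    (B : CartDiffCat.{w, v, u} k) (A : CartLinCat.{w, v, u} k) :
    ((CartDiffCat.forget k).obj B ⟶ A) ≃ (B ⟶ A.faa) where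
  toFun := Faa.desc (k := k) (A := A.carrier) (B := B.carrier)
  invFun G := (CartDiffCat.forget k).map G ≫ A.counit
  left_inv := Faa.desc_comp_ε (k := k) (A := A.carrier) (B := B.carrier)
  right_inv := Faa.desc_unique (k := k) (A := A.carrier) (B := B.carrier)

theorem CartDiffCat.faaHomEquiv_naturality (k : Type w) [CommSemiring k]
    (B' B : CartDiffCat.{w, v, u} k) (A : CartLinCat.{w, v, u} k) (G : B' ⟶ B)
    (F : (CartDiffCat.forget k).obj B ⟶ A) :
    faaHomEquiv k B' A ((CartDiffCat.forget k).map G ≫ F) = G ≫ faaHomEquiv k B A F := by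
  rw [← Equiv.eq_symm_apply]
  change _ = (CartDiffCat.forget k).map (G ≫ faaHomEquiv k B A F) ≫ A.counit
  rw [Functor.map_comp, Category.assoc]
  exact congrArg _ ((faaHomEquiv k B A).symm_apply_apply F).symm

theorem theorem3 (k : Type w) [CommSemiring k] :
    (∀ (A : Type u₁) [Category.{v₁} A] [CartesianMonoidalCategory A] [LeftAdditive A]
        [LeftLinear k A] [CartesianLeftLinear k A]
        (B : Type u₂) [Category.{v₂} B] [CartesianMonoidalCategory B] [LeftAdditive B]
        [LeftLinear k B] [CartesianLeftLinear k B] [CartesianDifferential k B]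
        (F : CartLinFunctor k B A),
        ∃! F' : CartDiffFunctor k B (Faa k A), F'.toCartLinFunctor.comp (Faa.ε k A) = F) ∧
      ∃ (R : CartLinCat.{w, v, u} k ⥤ CartDiffCat.{w, v, u} k)
        (adj : CartDiffCat.forget k ⊣ R) (hR : ∀ A : CartLinCat.{w, v, u} k, R.obj A = A.faa),
        ∀ A : CartLinCat.{w, v, u} k,
          (CartDiffCat.forget k).map (eqToHom (hR A).symm) ≫ adj.counit.app A = A.counit := by
  refine ⟨fun A _ _ _ _ _ B _ _ _ _ _ _ F => ⟨Faa.desc F, Faa.desc_comp_ε F, ?_⟩,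
    Adjunction.rightAdjointOfEquiv (CartDiffCat.faaHomEquiv k)
      (CartDiffCat.faaHomEquiv_naturality k),
    Adjunction.adjunctionOfEquivRight _ _, fun _ => rfl, fun A => ?_⟩
  · rintro G rfl
    exact (Faa.desc_unique G).symm
  · rw [eqToHom_refl, CategoryTheory.Functor.map_id, Category.id_comp]
    refine (Adjunction.mkOfHomEquiv_counit_app _ _).trans ?_
    change (CartDiffCat.forget k).map (𝟙 A.faa) ≫ A.counit = A.counit
    rw [CategoryTheory.Functor.map_id, Category.id_comp]
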